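/- Let $K$ be a field of characteristic $p>0$ (not necessarily perfect), let $\overline K$ be an algebraic closure of $K$, and let $G=\mathrm{Gal}(\overline K/K)$ be the group of $K$-automorphisms of $\overline K$ with the Krull topology. Let $A$ be a finite abelian $p$-group, with the discrete topology. A *twist* for the Hopf algebra $K[A]$ (with comultiplication $\Delta$ and counit $\varepsilon$) is an invertible $J\in K[A]\otimes K[A]$ with $(\Delta\otimes \mathrm{id})(J)(J\otimes 1)=(\mathrm{id}\otimes\Delta)(J)(1\otimes J)$ and $(\varepsilon\otimes \mathrm{id})(J)=1=(\mathrm{id}\otimes\varepsilon)(J)$. Two twists $I,J$ are *gauge equivalent* if $J=\Delta(x)I(x^{-1}\otimes x^{-1})$ for some invertible $x\in K[A]$ with $\varepsilon(x)=1$. Let $H^2_{\rm inv}(A,K)$ be the group, under multiplication, of gauge equivalence classes of twists. For a twist $J$, let $(K[A]_J)^*$ be the algebra of linear forms on $K[A]$ with product $(f*g)(h)=(f\otimes g)(\Delta(h)J)$ and unit $\varepsilon$, on which $A$ acts by $(a\cdot f)(h)=f(ha)$. An *$A$-torsor over $K$* is a commutative semisimple $K$-algebra $B$ with an action of $A$ by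 $K$-algebra automorphisms such that $\overline K\otimes_K B$ is $A$-equivariantly isomorphic, as a $\overline K$-algebra, to the algebra $\mathrm{Fun}(A,\overline K)$ with the action $(a\cdot F)(c)=F(ca)$. Isomorphisms of torsors are $A$-equivariant isomorphisms of $K$-algebras. Then: 1. The isomorphism classes of $A$-torsors over $K$ form an abelian group under $[B_1][B_2]=[(B_1\otimes_K B_2)^A]$, where in forming the invariants $a\in A$ acts on $B_1$ by $a$ and on $B_2$ by $a^{-1}$, and $A$ acts on $(B_1\otimes_K B_2)^A$ through the first factor. 2. Each $(K[A]_J)^*$ is an $A$-torsor, and $[J]\mapsto[(K[A]_J)^*]$ is a well-defined group isomorphism from $H^2_{\rm inv}(A,K)$ to the group of isomorphism classes of $A$-torsors over $K$. 3. There is a group isomorphism from the group of isomorphism classes of $A$-torsors over $K$ to the group $\mathrm{Hom}(G,A)$ of continuous homomorphisms, $[B]\mapsto\varphi_B$, characterized by $g(f(x))=f(\varphi_B(g)\cdot x)$ for every $K$-algebra homomorphism $f:B\to\overline K$, every $g\in G$ and every $x\in B$. In particular, the composition is a canonical group isomorphism $H^2_{\rm inv}(A,K)\cong\mathrm{Hom}(G,A)$.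 -/

import Mathlib

open scoped TensorProduct

noncomputable section

/-! ### Twists, gauge equivalence and the second invariant cohomology group -/

section Twists

universe u v

variable (K : Type u) (H : Type v) [CommRing K] [CommRing H] [Bialgebra K H]

/-- The algebra map `Δ ⊗ id : H ⊗ H → H ⊗ H ⊗ H`. -/
def comulLeft : H ⊗[K] H →ₐ[K] H ⊗[K] (H ⊗[K] H) :=
  (Algebra.TensorProduct.assoc K K K H H H).toAlgHom.comp
    (Algebra.TensorProduct.map (Bialgebra.comulAlgHom K H) (AlgHom.id K H))

/-- The algebra map `id ⊗ Δ : H ⊗ H → H ⊗ H ⊗ H`. -/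
def comulRight : H ⊗[K] H →ₐ[K] H ⊗[K] (H ⊗[K] H) :=
  Algebra.TensorProduct.map (AlgHom.id K H) (Bialgebra.comulAlgHom K H)

/-- The algebra map `J ↦ J ⊗ 1`. -/
def inclLeft : H ⊗[K] H →ₐ[K] H ⊗[K] (H ⊗[K] H) :=
  (Algebra.TensorProduct.assoc K K K H H H).toAlgHom.comp Algebra.TensorProduct.includeLeft

/-- The algebra map `J ↦ 1 ⊗ J`. -/
def inclRight : H ⊗[K] H →ₐ[K] H ⊗[K] (H ⊗[K] H) :=
  Algebra.TensorProduct.includeRight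

/-- The algebra map `ε ⊗ id : H ⊗ H → K ⊗ H`. -/
def counitLeft : H ⊗[K] H →ₐ[K] K ⊗[K] H :=
  Algebra.TensorProduct.map (Bialgebra.counitAlgHom K H) (AlgHom.id K H)

/-- The algebra map `id ⊗ ε : H ⊗ H → H ⊗ K`. -/
def counitRight : H ⊗[K] H →ₐ[K] H ⊗[K] K :=
  Algebra.TensorProduct.map (AlgHom.id K H) (Bialgebra.counitAlgHom K H)

/-- The group of twists of a commutative bialgebra `H`: the invertible `J ∈ H ⊗ H` with
`(Δ ⊗ id)(J) (J ⊗ 1) = (id ⊗ Δ)(J) (1 ⊗ J)` and `(ε ⊗ id)(J) = 1 = (id ⊗ ε)(J)`. As `H` is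
commutative they form a group under multiplication. -/
def twistGroup : Subgroup (H ⊗[K] H)ˣ where
  carrier := {J | comulLeft K H J * inclLeft K H J = comulRight K H J * inclRight K H J ∧
    counitLeft K H J = 1 ∧ counitRight K H J = 1}
  one_mem' := by simp
  mul_mem' := by
    rintro I J ⟨h1, h2, h3⟩ ⟨k1, k2, k3⟩
    refine ⟨?_, by simp [h2, k2], by simp [h3, k3]⟩
    simp only [Units.val_mul, map_mul]
    rw [mul_mul_mul_comm, h1, k1, mul_mul_mul_comm]
  inv_mem' := by
    rintro J ⟨h1, h2, h3⟩
    have key : ∀ {S : Type v} [CommRing S] [Algebra K S] (f : H ⊗[K] H →ₐ[K] S),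
        f J * f ((J⁻¹ : (H ⊗[K] H)ˣ) : H ⊗[K] H) = 1 := by
      intro S _ _ f
      rw [← map_mul, Units.mul_inv, map_one]
    refine ⟨?_, ?_, ?_⟩
    · have e1 := key (comulLeft K H)
      have e2 := key (inclLeft K H)
      have e3 := key (comulRight K H)
      have e4 := key (inclRight K H)
      set J' : H ⊗[K] H := ((J⁻¹ : (H ⊗[K] H)ˣ) : H ⊗[K] H)
      calc _ = comulLeft K H J' * inclLeft K H J' *
            ((comulRight K H J * comulRight K H J') * (inclRight K H J * inclRight K H J')) := by
              rw [e3, e4]; ring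
        _ = (comulRight K H J * inclRight K H J) * (comulLeft K H J' * inclLeft K H J') *
            (comulRight K H J' * inclRight K H J') := by ring
        _ = (comulLeft K H J * comulLeft K H J') * (inclLeft K H J * inclLeft K H J') *
            (comulRight K H J' * inclRight K H J') := by rw [← h1]; ring
        _ = _ := by rw [e1, e2]; ring
    · have e : counitLeft K H J * counitLeft K H ((J⁻¹ : (H ⊗[K] H)ˣ) : H ⊗[K] H) = 1 := by
        rw [← map_mul, Units.mul_inv, map_one]
      rwa [h2, one_mul] at e
    · have e : counitRight K H J * counitRight K H ((J⁻¹ : (H ⊗[K] H)ˣ) : H ⊗[K] H) = 1 := by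
        rw [← map_mul, Units.mul_inv, map_one]
      rwa [h3, one_mul] at e

/-- Gauge equivalence of twists: `J = Δ(x) I (x⁻¹ ⊗ x⁻¹)` for an invertible `x ∈ H` with
`ε(x) = 1`. -/
def GaugeEquiv (I J : H ⊗[K] H) : Prop :=
  ∃ x : Hˣ, Coalgebra.counit (R := K) (x : H) = 1 ∧
    J = Coalgebra.comul (R := K) (x : H) * I * (((x⁻¹ : Hˣ) : H) ⊗ₜ[K] ((x⁻¹ : Hˣ) : H))

/-- The subgroup of the twists that are gauge equivalent to `1 ⊗ 1`. -/
def trivialTwists : Subgroup (twistGroup K H) where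
  carrier := {J | GaugeEquiv K H 1 (J : (H ⊗[K] H)ˣ)}
  one_mem' := ⟨1, by simp, by simp [Algebra.TensorProduct.one_def]⟩
  mul_mem' := by
    rintro I J ⟨x, hx, hI⟩ ⟨y, hy, hJ⟩
    refine ⟨x * y, by simp [hx, hy], ?_⟩
    rw [Subgroup.coe_mul, Units.val_mul, hI, hJ, mul_inv, Units.val_mul, Units.val_mul,
      ← Algebra.TensorProduct.tmul_mul_tmul, Bialgebra.comul_mul]
    ring
  inv_mem' := by
    rintro J ⟨x, hx, hJ⟩
    have hx' : Coalgebra.counit (R := K) ((x⁻¹ : Hˣ) : H) = 1 := by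
      have h : Coalgebra.counit (R := K) ((x : H) * ((x⁻¹ : Hˣ) : H)) = 1 := by simp
      rwa [Bialgebra.counit_mul, hx, one_mul] at h
    refine ⟨x⁻¹, hx', ?_⟩
    rw [InvMemClass.coe_inv]
    refine Units.inv_eq_of_mul_eq_one_right ?_
    have h1 : Coalgebra.comul (R := K) (x : H) * Coalgebra.comul (R := K) ((x⁻¹ : Hˣ) : H) = 1 := by
      rw [← Bialgebra.comul_mul]; simp
    have h2 : (((x⁻¹ : Hˣ) : H) ⊗ₜ[K] ((x⁻¹ : Hˣ) : H)) * ((x : H) ⊗ₜ[K] (x : H)) = 1 := by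
      simp [Algebra.TensorProduct.one_def]
    rw [hJ, inv_inv]
    calc _ = (Coalgebra.comul (R := K) (x : H) * Coalgebra.comul (R := K) ((x⁻¹ : Hˣ) : H)) *
          ((((x⁻¹ : Hˣ) : H) ⊗ₜ[K] ((x⁻¹ : Hˣ) : H)) * ((x : H) ⊗ₜ[K] (x : H))) := by ring
      _ = 1 := by rw [h1, h2, one_mul]

/-- Gauge equivalence classes of twists of the commutative bialgebra `H`, with the group
structure induced by multiplication of twists. -/
abbrev TwistClasses : Type v := twistGroup K H ⧸ trivialTwists K H

/-- Two twists define the same class exactly when they are gauge equivalent. -/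
theorem twistClasses_mk_eq_iff (I J : twistGroup K H) :
    (QuotientGroup.mk I : TwistClasses K H) = QuotientGroup.mk J ↔
      GaugeEquiv K H ((I : (H ⊗[K] H)ˣ) : H ⊗[K] H) ((J : (H ⊗[K] H)ˣ) : H ⊗[K] H) := by
  rw [QuotientGroup.eq]
  constructor
  · rintro ⟨x, hx, h⟩
    refine ⟨x, hx, ?_⟩
    rw [Subgroup.coe_mul, Units.val_mul, InvMemClass.coe_inv, Units.inv_mul_eq_iff_eq_mul] at h
    rw [h]; ring
  · rintro ⟨x, hx, h⟩
    refine ⟨x, hx, ?_⟩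
    rw [Subgroup.coe_mul, Units.val_mul, InvMemClass.coe_inv, Units.inv_mul_eq_iff_eq_mul, h]
    ring

variable {K H}

/-- The coalgebra `H_J`: the module `H` with comultiplication `h ↦ Δ(h) J` and counit `ε`. -/
def TwistedCoalgebra (_J : twistGroup K H) : Type v := H

namespace TwistedCoalgebra

variable (J : twistGroup K H)

instance : AddCommGroup (TwistedCoalgebra J) := inferInstanceAs (AddCommGroup H)
instance : Module K (TwistedCoalgebra J) := inferInstanceAs (Module K H)

/-- The map `h ↦ Δ(h) J`. -/
def twistedComul : H →ₗ[K] H ⊗[K] H :=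
  LinearMap.mulRight K ((J : (H ⊗[K] H)ˣ) : H ⊗[K] H) ∘ₗ Coalgebra.comul

/-- The counit `ε`, as a map on `H_J`. -/
def twistedCounit (_J : twistGroup K H) : H →ₗ[K] K := Coalgebra.counit

theorem twistedComul_apply (h : H) :
    twistedComul J h = Coalgebra.comul h * ((J : (H ⊗[K] H)ˣ) : H ⊗[K] H) := rfl

theorem assoc_rTensor (y : H ⊗[K] H) :
    TensorProduct.assoc K H H H ((twistedComul J).rTensor H y) =
      comulLeft K H y * inclLeft K H ((J : (H ⊗[K] H)ˣ) : H ⊗[K] H) := by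
  have h : (twistedComul J).rTensor H y =
      Algebra.TensorProduct.map (Bialgebra.comulAlgHom K H) (AlgHom.id K H) y *
        (((J : (H ⊗[K] H)ˣ) : H ⊗[K] H) ⊗ₜ[K] (1 : H)) := by
    induction y with
    | zero => simp
    | add a b ha hb => rw [map_add, map_add, ha, hb, add_mul]
    | tmul a b => simp [twistedComul_apply]
  rw [h]
  exact map_mul (Algebra.TensorProduct.assoc K K K H H H) _ _

theorem lTensor_eq (y : H ⊗[K] H) :
    (twistedComul J).lTensor H y =
      comulRight K H y * inclRight K H ((J : (H ⊗[K] H)ˣ) : H ⊗[K] H) := by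
  induction y with
  | zero => simp
  | add a b ha hb => rw [map_add, map_add, ha, hb, add_mul]
  | tmul a b => simp [twistedComul_apply, comulRight, inclRight]

theorem comulLeft_comul (h : H) :
    comulLeft K H (Coalgebra.comul h) = comulRight K H (Coalgebra.comul h) :=
  Coalgebra.coassoc_apply h

theorem coassoc_apply (h : H) :
    TensorProduct.assoc K H H H ((twistedComul J).rTensor H (twistedComul J h)) =
      (twistedComul J).lTensor H (twistedComul J h) := by
  rw [assoc_rTensor, lTensor_eq, twistedComul_apply, map_mul, map_mul, mul_assoc, mul_assoc,
    J.2.1, comulLeft_comul]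

theorem rTensor_counit (h : H) : (twistedCounit J).rTensor H (twistedComul J h) = 1 ⊗ₜ h := by
  change counitLeft K H (Coalgebra.comul h * ((J : (H ⊗[K] H)ˣ) : H ⊗[K] H)) = 1 ⊗ₜ h
  rw [map_mul, J.2.2.1, mul_one]
  exact Coalgebra.rTensor_counit_comul h

theorem lTensor_counit (h : H) : (twistedCounit J).lTensor H (twistedComul J h) = h ⊗ₜ 1 := by
  change counitRight K H (Coalgebra.comul h * ((J : (H ⊗[K] H)ˣ) : H ⊗[K] H)) = h ⊗ₜ 1
  rw [map_mul, J.2.2.2, mul_one]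
  exact Coalgebra.lTensor_counit_comul h

instance : Coalgebra K (TwistedCoalgebra J) where
  comul := twistedComul (H := H) J
  counit := twistedCounit (H := H) J
  coassoc := LinearMap.ext (coassoc_apply J)
  rTensor_counit_comp_comul := LinearMap.ext (rTensor_counit J)
  lTensor_counit_comp_comul := LinearMap.ext (lTensor_counit J)

end TwistedCoalgebra

/-- The algebra `(H_J)^*` dual to the coalgebra `H_J`: linear forms on `H` with the product
`(f * g)(h) = (f ⊗ g)(Δ(h) J)` and unit `ε`. -/
abbrev TwistedDual (J : twistGroup K H) : Type (max u v) :=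
  WithConv (TwistedCoalgebra J →ₗ[K] K)

end Twists

/-! ### Algebras with an action of a group, and torsors -/

section Torsors

universe u v w

/-- Two `K`-algebras with `A`-action (given by `ρ` and `σ`) are isomorphic if there is an
`A`-equivariant isomorphism of `K`-algebras. -/
def EquivariantIso {K A B C : Type*} [CommRing K] [Monoid A] [Semiring B] [Algebra K B]
    [Semiring C] [Algebra K C] (ρ : A →* (B ≃ₐ[K] B)) (σ : A →* (C ≃ₐ[K] C)) : Prop :=
  ∃ e : B ≃ₐ[K] C, ∀ (a : A) (x : B), e (ρ a x) = σ a (e x)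

variable (K : Type u) (A : Type v) [Field K] [CommGroup A]

/-- An `A`-torsor over `K`: a commutative semisimple `K`-algebra `B` with an action of `A` by
algebra automorphisms such that `K̄ ⊗ B` is isomorphic to `Fun(A, K̄)` as a `K̄`-algebra with
`A`-action, where `a ∈ A` acts on functions by `(a · F)(c) = F (c a)`. -/
structure ATorsor : Type (max u v + 1) where
  carrier : Type (max u v)
  [commRing : CommRing carrier]
  [algebra : Algebra K carrier]
  [semisimple : IsSemisimpleRing carrier]
  ρ : A →* (carrier ≃ₐ[K] carrier)
  split : ∃ φ : AlgebraicClosure K ⊗[K] carrier ≃ₐ[AlgebraicClosure K] (A → AlgebraicClosure K),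
    ∀ (a c : A) (s : AlgebraicClosure K) (x : carrier),
      φ (s ⊗ₜ[K] ρ a x) c = φ (s ⊗ₜ[K] x) (c * a)

attribute [instance] ATorsor.commRing ATorsor.algebra ATorsor.semisimple

/-- Isomorphism of `A`-torsors. -/
instance ATorsor.setoid : Setoid (ATorsor K A) where
  r B C := EquivariantIso B.ρ C.ρ
  iseqv :=
    { refl := fun _ => ⟨AlgEquiv.refl, fun _ _ => rfl⟩
      symm := fun {B C} ⟨e, he⟩ => ⟨e.symm, fun a x => by
        rw [AlgEquiv.symm_apply_eq, he, AlgEquiv.apply_symm_apply]⟩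
      trans := fun ⟨e, he⟩ ⟨f, hf⟩ => ⟨e.trans f, fun a x => by
        simp [he, hf]⟩ }

/-- Isomorphism classes of `A`-torsors over `K`. -/
def TorsorClasses : Type (max u v + 1) := Quotient (ATorsor.setoid K A)

variable {K A}

/-- The isomorphism class of a torsor. -/
def ATorsor.cls (B : ATorsor K A) : TorsorClasses K A := Quotient.mk _ B

section Product

variable {B C : Type w} [CommRing B] [Algebra K B] [CommRing C] [Algebra K C]
  (ρ : A →* (B ≃ₐ[K] B)) (σ : A →* (C ≃ₐ[K] C))

/-- The subalgebra `(B ⊗ C)^A`, where `a ∈ A` acts on `B` by `a` and on `C` by `a⁻¹`. -/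
def antiInvariants : Subalgebra K (B ⊗[K] C) where
  carrier := {x | ∀ a : A,
    Algebra.TensorProduct.map (ρ a).toAlgHom (σ a⁻¹).toAlgHom x = x}
  mul_mem' := fun hx hy a => by rw [map_mul, hx a, hy a]
  add_mem' := fun hx hy a => by rw [map_add, hx a, hy a]
  algebraMap_mem' := fun r a => AlgHom.commutes _ r

/-- The action of `a` on `B ⊗ C` through the first factor. -/
def actLeft (a : A) : B ⊗[K] C →ₐ[K] B ⊗[K] C :=
  Algebra.TensorProduct.map (ρ a).toAlgHom (AlgHom.id K C)

theorem actLeft_mem (a : A) (x : B ⊗[K] C) (hx : x ∈ antiInvariants ρ σ) :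
    actLeft (C := C) ρ a x ∈ antiInvariants ρ σ := by
  intro b
  have h : (Algebra.TensorProduct.map (ρ b).toAlgHom (σ b⁻¹).toAlgHom).comp
      (actLeft (C := C) ρ a) = (actLeft (C := C) ρ a).comp
        (Algebra.TensorProduct.map (ρ b).toAlgHom (σ b⁻¹).toAlgHom) := by
    refine Algebra.TensorProduct.ext' fun y z => ?_
    have e : ρ b (ρ a y) = ρ a (ρ b y) := by
      rw [← AlgEquiv.mul_apply, ← AlgEquiv.mul_apply, ← map_mul, ← map_mul, mul_comm]
    simp [actLeft, e]
  have := DFunLike.congr_fun h x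
  simp only [AlgHom.comp_apply] at this
  rw [this, hx b]

theorem actLeft_mul_apply (a b : A) (x : B ⊗[K] C) :
    actLeft (C := C) ρ (a * b) x = actLeft (C := C) ρ a (actLeft (C := C) ρ b x) := by
  induction x with
  | zero => simp
  | add y z hy hz => simp only [map_add, hy, hz]
  | tmul y z => simp [actLeft]

theorem actLeft_one_apply (x : B ⊗[K] C) : actLeft (C := C) ρ (1 : A) x = x := by
  induction x with
  | zero => simp
  | add y z hy hz => simp only [map_add, hy, hz]
  | tmul y z => simp [actLeft]

/-- The action of `A` on `(B ⊗ C)^A` through the first factor (equivalently, through the second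
factor). -/
def antiInvariantsAction : A →* (antiInvariants ρ σ ≃ₐ[K] antiInvariants ρ σ) where
  toFun a :=
    { toFun := fun x => ⟨actLeft ρ a x, actLeft_mem ρ σ a x x.2⟩
      invFun := fun x => ⟨actLeft ρ a⁻¹ x, actLeft_mem ρ σ a⁻¹ x x.2⟩
      left_inv := fun x => Subtype.ext <| by
        change actLeft ρ a⁻¹ (actLeft ρ a (x : B ⊗[K] C)) = x
        rw [← actLeft_mul_apply, inv_mul_cancel, actLeft_one_apply]
      right_inv := fun x => Subtype.ext <| by
        change actLeft ρ a (actLeft ρ a⁻¹ (x : B ⊗[K] C)) = x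
        rw [← actLeft_mul_apply, mul_inv_cancel, actLeft_one_apply]
      map_mul' := fun x y => Subtype.ext (map_mul (actLeft ρ a) (x : B ⊗[K] C) y)
      map_add' := fun x y => Subtype.ext (map_add (actLeft ρ a) (x : B ⊗[K] C) y)
      commutes' := fun r => Subtype.ext ((actLeft (C := C) ρ a).commutes r) }
  map_one' := AlgEquiv.ext fun x => Subtype.ext (actLeft_one_apply ρ (x : B ⊗[K] C))
  map_mul' a b := AlgEquiv.ext fun x => Subtype.ext (actLeft_mul_apply ρ a b (x : B ⊗[K] C))

end Product

end Torsors

/-! ### The case of a group algebra -/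

section GroupAlgebra

universe u v

/-- The group `H²_inv(A, K)` of gauge equivalence classes of twists for the Hopf algebra `K[A]`. -/
abbrev H2inv (A : Type v) (K : Type u) [CommGroup A] [Field K] : Type (max u v) :=
  TwistClasses K (MonoidAlgebra K A)

variable {K : Type u} {A : Type v} [Field K] [CommGroup A]

variable (J : twistGroup K (MonoidAlgebra K A))

/-- The translation `h ↦ h a` of `K[A]` by a group element `a`, as a map of `K[A]_J`. -/
def groupTranslate (a : A) : TwistedCoalgebra J →ₗ[K] TwistedCoalgebra J :=
  (LinearMap.mulRight K (MonoidAlgebra.of K A a) : MonoidAlgebra K A →ₗ[K] MonoidAlgebra K A)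

theorem groupTranslate_mul (a b : A) (h : TwistedCoalgebra J) :
    groupTranslate J (a * b) h = groupTranslate J a (groupTranslate J b h) := by
  have main : ∀ h : MonoidAlgebra K A, h * MonoidAlgebra.of K A (a * b) =
      (h * MonoidAlgebra.of K A b) * MonoidAlgebra.of K A a := by
    intro h
    rw [mul_comm a b, map_mul, mul_assoc]
  exact main h

theorem groupTranslate_one (h : TwistedCoalgebra J) : groupTranslate J (1 : A) h = h := by
  have main : ∀ h : MonoidAlgebra K A, h * MonoidAlgebra.of K A 1 = h := by
    intro h
    rw [map_one, mul_one]
  exact main h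

theorem groupTranslate_inv_left (a : A) (h : TwistedCoalgebra J) :
    groupTranslate J a⁻¹ (groupTranslate J a h) = h := by
  rw [← groupTranslate_mul, inv_mul_cancel, groupTranslate_one]

theorem groupTranslate_inv_right (a : A) (h : TwistedCoalgebra J) :
    groupTranslate J a (groupTranslate J a⁻¹ h) = h := by
  rw [← groupTranslate_mul, mul_inv_cancel, groupTranslate_one]

theorem counit_groupTranslate (a : A) (h : TwistedCoalgebra J) :
    Coalgebra.counit (R := K) (groupTranslate J a h) = Coalgebra.counit (R := K) h := by
  have main : ∀ h : MonoidAlgebra K A,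
      Coalgebra.counit (R := K) (h * MonoidAlgebra.of K A a) = Coalgebra.counit (R := K) h := by
    intro h
    rw [Bialgebra.counit_mul]
    simp
  exact main h

theorem comul_groupTranslate (a : A) (h : TwistedCoalgebra J) :
    Coalgebra.comul (R := K) (groupTranslate J a h) =
      TensorProduct.map (groupTranslate J a) (groupTranslate J a) (Coalgebra.comul (R := K) h) := by
  have key : ∀ y : MonoidAlgebra K A ⊗[K] MonoidAlgebra K A,
      TensorProduct.map (LinearMap.mulRight K (MonoidAlgebra.of K A a))
        (LinearMap.mulRight K (MonoidAlgebra.of K A a)) y =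
        y * (MonoidAlgebra.of K A a ⊗ₜ[K] MonoidAlgebra.of K A a) := by
    intro y
    induction y with
    | zero => simp
    | add p q hp hq => rw [map_add, hp, hq, add_mul]
    | tmul p q => simp
  have hc : Coalgebra.comul (R := K) (MonoidAlgebra.of K A a) =
      MonoidAlgebra.of K A a ⊗ₜ[K] MonoidAlgebra.of K A a := by
    simp
  have main : ∀ h : MonoidAlgebra K A,
      TwistedCoalgebra.twistedComul J (h * MonoidAlgebra.of K A a) =
        TensorProduct.map (LinearMap.mulRight K (MonoidAlgebra.of K A a))
          (LinearMap.mulRight K (MonoidAlgebra.of K A a)) (TwistedCoalgebra.twistedComul J h) := by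
    intro h
    rw [key, TwistedCoalgebra.twistedComul_apply, TwistedCoalgebra.twistedComul_apply,
      Bialgebra.comul_mul, hc]
    ring
  exact main h

/-- `(a · f)(h) = f (h a)` for `f ∈ (K[A]_J)^*`. -/
def dualAct (a : A) (f : TwistedDual J) : TwistedDual J :=
  WithConv.toConv (f.ofConv ∘ₗ groupTranslate J a)

theorem dualAct_mul (a : A) (f g : TwistedDual J) :
    dualAct J a (f * g) = dualAct J a f * dualAct J a g := by
  apply WithConv.ofConv_injective
  refine LinearMap.ext fun h => ?_
  change LinearMap.mul' K K (TensorProduct.map f.ofConv g.ofConv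
      (Coalgebra.comul (groupTranslate J a h))) =
    LinearMap.mul' K K (TensorProduct.map (f.ofConv ∘ₗ groupTranslate J a)
      (g.ofConv ∘ₗ groupTranslate J a) (Coalgebra.comul h))
  rw [comul_groupTranslate, TensorProduct.map_comp]
  rfl

theorem dualAct_algebraMap (a : A) (r : K) :
    dualAct J a (algebraMap K (TwistedDual J) r) = algebraMap K (TwistedDual J) r := by
  apply WithConv.ofConv_injective
  refine LinearMap.ext fun h => ?_
  change r * Coalgebra.counit (R := K) (groupTranslate J a h) = r * Coalgebra.counit (R := K) h
  rw [counit_groupTranslate]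

/-- The action of `A` on the algebra `(K[A]_J)^*` by algebra automorphisms,
`(a · f)(h) = f (h a)`. -/
def dualAction : A →* (TwistedDual J ≃ₐ[K] TwistedDual J) where
  toFun a :=
    { toFun := dualAct J a
      invFun := dualAct J a⁻¹
      left_inv := fun f => WithConv.ofConv_injective <| LinearMap.ext fun h =>
        congrArg f.ofConv (groupTranslate_inv_right J a h)
      right_inv := fun f => WithConv.ofConv_injective <| LinearMap.ext fun h =>
        congrArg f.ofConv (groupTranslate_inv_left J a h)
      map_mul' := dualAct_mul J a
      map_add' := fun _ _ => rfl
      commutes' := dualAct_algebraMap J a }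
  map_one' := AlgEquiv.ext fun f => WithConv.ofConv_injective <| LinearMap.ext fun h =>
    congrArg f.ofConv (groupTranslate_one J h)
  map_mul' a b := AlgEquiv.ext fun f => WithConv.ofConv_injective <| LinearMap.ext fun h =>
    congrArg f.ofConv <| by rw [mul_comm a b, groupTranslate_mul]

end GroupAlgebra

end

/-! Everything is compared with continuous characters of `G`, through points over the algebraic
closure Ω of K.

Torsors. The Ω-points of a torsor B form a set of |A| = dim B points on which A acts simply
transitively by translation. The Galois action commutes with translation, so `g` moves every point
by one and the same element of A, and this gives the character. Conversely the points with their
Galois action recover B. By Dedekind independence the matrix of values of the points on a basis is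
invertible, so a Galois-compatible function on the points comes from a unique element of B as soon
as its values are separable (`SplittingFamily.exists_descent`). Over an imperfect K the separability
has to be proved. Frobenius keeps the matrix invertible, so high p-powers of a basis are again a
basis, and the points take separable values on them (`SplittingFamily.mem_separableClosure`).

Twists. An Ω-point of the twisted dual is an `x` in Ω[A] with ε(x) = 1 and Δ(x) J = x ⊗ x, that is,
a trivialization of J over Ω. Points exist because the dual is commutative, i.e. J is symmetric
(`twist_symmetric`). The ratio of J to its flip is a bicharacter, hence its K[A]-valued coefficients
are idempotents. In K[A] a p^n-th power is a scalar, so idempotents are scalars, and augmentation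
shows that the ratio is 1. For the same reason `x` is a unit, its |A| translates are distinct, and
the dual is a torsor. Galois acts by `g(x) = x φ(g)`.

Trivializations multiply, so J ↦ φ is a homomorphism. If φ = 1 then `x` is fixed with separable
coefficients, so it lies in K[A] and J is a coboundary (`ker_twistCharacter`). Given φ, a resolvent
Σ τ(v) φ(τ)⁻¹, with v separable and Σ τ(v) = 1, transforms by φ, and (x ⊗ x) Δ(x)⁻¹ is
Galois-invariant, hence a twist over K (`exists_semiinvariant`, `exists_twist_of_semiinvariant`).

Thus both sides are identified with Hom(G, A). The group law on torsors is transported from there,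
and the formula with (B ⊗ C)^A is checked on points. -/

noncomputable section

/-! ### Group algebras of abelian p-groups in characteristic p -/

section MonoidAlgebraCharP

variable {R A : Type*} [CommRing R] [CommGroup A]

/-- The augmentation of the group algebra. -/
def augmentation (R A : Type*) [CommRing R] [CommGroup A] : MonoidAlgebra R A →ₐ[R] R :=
  MonoidAlgebra.lift R R A 1

@[simp]
theorem augmentation_single (a : A) (r : R) :
    augmentation R A (MonoidAlgebra.single a r) = r := by
  simp [augmentation]

/-- The p^n-th power map is additive in characteristic p, so only monomials matter, and there the
group element is killed. -/
theorem MonoidAlgebra.pow_eq_of_torsion (p n : ℕ) [Fact p.Prime] [CharP R p]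
    (hA : ∀ a : A, a ^ p ^ n = 1) (x : MonoidAlgebra R A) :
    x ^ p ^ n = algebraMap R _ (augmentation R A x ^ p ^ n) := by
  have : CharP (MonoidAlgebra R A) p :=
    charP_of_injective_algebraMap (R := R) (fun a b h => by
      simpa using congrArg (augmentation R A) h) p
  induction x using MonoidAlgebra.induction_linear with
  | zero => simp [(Fact.out : p.Prime).ne_zero]
  | add x y hx hy => rw [add_pow_char_pow, hx, hy, map_add, add_pow_char_pow, map_add]
  | single a r => simp [MonoidAlgebra.single_pow, hA]

theorem MonoidAlgebra.isUnit_of_isUnit_augmentation (p n : ℕ) [Fact p.Prime] [CharP R p]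
    (hA : ∀ a : A, a ^ p ^ n = 1) {x : MonoidAlgebra R A} (hx : IsUnit (augmentation R A x)) :
    IsUnit x := by
  rw [← isUnit_pow_iff (pow_ne_zero n (Fact.out : p.Prime).ne_zero),
    MonoidAlgebra.pow_eq_of_torsion p n hA]
  exact (hx.pow _).map _

/-- An idempotent is its own p^n-th power, and such powers are scalars. -/
theorem MonoidAlgebra.eq_algebraMap_of_idempotent (p n : ℕ) [Fact p.Prime] [CharP R p]
    (hA : ∀ a : A, a ^ p ^ n = 1) {x : MonoidAlgebra R A} (hx : IsIdempotentElem x) :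
    x = algebraMap R _ (augmentation R A x) := by
  have hq : p ^ n ≠ 0 := pow_ne_zero n (Fact.out : p.Prime).ne_zero
  have h := MonoidAlgebra.pow_eq_of_torsion p n hA x
  rwa [← map_pow, hx.pow_eq hq] at h

theorem IsPGroup.exists_pow_eq_one {p : ℕ} [Fact p.Prime] [Finite A] (hA : IsPGroup p A) :
    ∃ n : ℕ, ∀ a : A, a ^ p ^ n = 1 := by
  obtain ⟨n, hn⟩ := (IsPGroup.iff_card).1 hA
  exact ⟨n, fun a => by rw [← hn, pow_card_eq_one']⟩

end MonoidAlgebraCharP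

/-! ### Algebras split by a family of points -/

section Points

variable {K E L X : Type*} [Field K] [CommRing E] [Algebra K E] [Field L] [Algebra K L]

/-- A family of `L`-valued points of a finite-dimensional `K`-algebra `E` that splits `E`: the
points are distinct and their number is the dimension of `E`. -/
structure SplittingFamily [Fintype X] (f : X → (E →ₐ[K] L)) : Prop where
  finite : Module.Finite K E
  injective : Function.Injective f
  card_eq : Fintype.card X = Module.finrank K E

namespace SplittingFamily

/-- The evaluation `L ⊗ E → Fun(X, L)`. -/
def evalHom (f : X → (E →ₐ[K] L)) : L ⊗[K] E →ₐ[L] (X → L) :=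
  Algebra.TensorProduct.lift (Algebra.ofId L (X → L)) (AlgHom.pi f) fun _ _ => .all _ _

theorem evalHom_tmul (f : X → (E →ₐ[K] L)) (s : L) (v : E) (x : X) :
    evalHom f (s ⊗ₜ v) x = s * f x v := by
  simp [evalHom, Algebra.ofId_apply]

variable [Fintype X] {f : X → (E →ₐ[K] L)}

/-- A basis of `E` indexed by the points. -/
def basis (hf : SplittingFamily f) : Module.Basis X K E :=
  haveI := hf.finite
  (Module.finBasis K E).reindex
    ((finCongr hf.card_eq.symm).trans (Fintype.equivFin X).symm)

/-- Dedekind independence of algebra homomorphisms: a relation between the rows is a relation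
between the points, tested on a basis. -/
theorem isUnit_matrix [DecidableEq X] (hf : SplittingFamily f) (e : Module.Basis X K E) :
    IsUnit (Matrix.of fun x i => f x (e i)) := by
  rw [← Matrix.linearIndependent_rows_iff_isUnit, Fintype.linearIndependent_iff]
  intro c hc
  have hli := (linearIndependent_algHom_toLinearMap K E L).comp f hf.injective
  rw [Fintype.linearIndependent_iff] at hli
  refine hli c (e.ext fun i => ?_)
  have := congrFun hc i
  simpa [Matrix.row, Finset.sum_apply] using this

theorem exists_eq_sum (hf : SplittingFamily f) (e : Module.Basis X K E) (F : X → L) :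
    ∃ s : X → L, ∀ x, F x = ∑ i, s i * f x (e i) := by
  classical
  obtain ⟨s, hs⟩ := (Matrix.mulVec_surjective_iff_isUnit.2 (hf.isUnit_matrix e)) F
  exact ⟨s, fun x => by
    rw [← hs]; exact Finset.sum_congr rfl fun i _ => mul_comm _ _⟩

theorem coeff_unique (hf : SplittingFamily f) (e : Module.Basis X K E) {s t : X → L}
    (h : ∀ x, ∑ i, s i * f x (e i) = ∑ i, t i * f x (e i)) : s = t := by
  classical
  refine (Matrix.mulVec_injective_iff_isUnit.2 (hf.isUnit_matrix e)) (funext fun x => ?_)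
  simpa [Matrix.mulVec, dotProduct, mul_comm] using h x

theorem ext_points (hf : SplittingFamily f) {v w : E} (h : ∀ x, f x v = f x w) : v = w := by
  have key : ∀ (v : E) x, f x v = ∑ i, algebraMap K L (hf.basis.repr v i) * f x (hf.basis i) := by
    intro v x
    conv_lhs => rw [← hf.basis.sum_repr v]
    simp [Algebra.smul_def]
  have := hf.coeff_unique hf.basis (s := fun i => algebraMap K L (hf.basis.repr v i))
    (t := fun i => algebraMap K L (hf.basis.repr w i)) fun x => by rw [← key, ← key, h]
  refine hf.basis.repr.injective (Finsupp.ext fun i => ?_)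
  exact (algebraMap K L).injective (congrFun this i)

theorem evalHom_bijective (hf : SplittingFamily f) : Function.Bijective (evalHom f) := by
  have := hf.finite
  have hsurj : Function.Surjective (evalHom f) := by
    intro F
    obtain ⟨s, hs⟩ := hf.exists_eq_sum hf.basis F
    refine ⟨∑ i, s i ⊗ₜ hf.basis i, funext fun x => ?_⟩
    rw [map_sum, Finset.sum_apply, hs]
    simp only [evalHom_tmul]
  refine ⟨?_, hsurj⟩
  refine (LinearMap.injective_iff_surjective_of_finrank_eq_finrank
    (f := (evalHom f).toLinearMap) ?_).2 hsurj
  rw [Module.finrank_baseChange, Module.finrank_pi, hf.card_eq]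

theorem isReduced (hf : SplittingFamily f) : IsReduced E :=
  isReduced_of_injective (AlgHom.pi f)
    fun _ _ h => hf.ext_points fun x => congrFun h x

end SplittingFamily

end Points

/-! ### Galois descent over a possibly imperfect field -/

section GaloisDescent

variable {K E Ω X : Type*} [Field K] [CommRing E] [Algebra K E] [Field Ω] [Algebra K Ω]
  [Fintype X]

/-- Some p^N-th powers of all values on a basis are separable. Frobenius preserves invertibility of
the matrix of values, so the p^N-th powers of the basis vectors are still a K-basis of E, on which
the points have separable values. -/
theorem SplittingFamily.mem_separableClosure [Algebra.IsAlgebraic K Ω] (p : ℕ) [Fact p.Prime]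
    [CharP K p] {f : X → (E →ₐ[K] Ω)} (hf : SplittingFamily f) (x : X) (v : E) :
    f x v ∈ separableClosure K Ω := by
  classical
  have : CharP Ω p := charP_of_injective_algebraMap (algebraMap K Ω).injective p
  have : CharP (separableClosure K Ω) p :=
    charP_of_injective_algebraMap (algebraMap K (separableClosure K Ω)).injective p
  have hp : ExpChar (separableClosure K Ω) p := ExpChar.prime Fact.out
  have hp' : ExpChar Ω p := ExpChar.prime Fact.out
  have e := hf.basis
  have h1 : ∀ y i, ∃ n : ℕ, f y (e i) ^ p ^ n ∈ separableClosure K Ω := by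
    intro y i
    obtain ⟨n, z, hz⟩ := IsPurelyInseparable.pow_mem (separableClosure K Ω) p (f y (e i))
    exact ⟨n, hz ▸ z.2⟩
  choose n hn using h1
  obtain ⟨N, hN⟩ : ∃ N, ∀ y i, n y i ≤ N :=
    ⟨∑ y, ∑ i, n y i, fun y i =>
      (Finset.single_le_sum (f := fun i => n y i) (fun _ _ => Nat.zero_le _)
        (Finset.mem_univ i)).trans (Finset.single_le_sum (f := fun y => ∑ i, n y i)
        (fun _ _ => Nat.zero_le _) (Finset.mem_univ y))⟩
  have hsep : ∀ y i, f y (e i) ^ p ^ N ∈ separableClosure K Ω := by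
    intro y i
    obtain ⟨d, hd⟩ := Nat.exists_eq_add_of_le (hN y i)
    rw [hd, pow_add, pow_mul]
    exact pow_mem (hn y i) _
  have hunit : IsUnit ((Matrix.of fun x i => f x (e i)).map (iterateFrobenius Ω p N)) := by
    have := (hf.isUnit_matrix e).map (iterateFrobenius Ω p N).mapMatrix
    simpa using this
  -- A relation between the powers would give a kernel vector of the Frobenius twist of the matrix
  -- of values.
  have hli : LinearIndependent K fun i => e i ^ p ^ N := by
    rw [Fintype.linearIndependent_iff]
    intro c hc
    have h0 : (fun i => algebraMap K Ω (c i)) = 0 := by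
      refine Matrix.mulVec_injective_iff_isUnit.2 hunit (funext fun y => ?_)
      have := congrArg (f y) hc
      simpa [Matrix.mulVec, dotProduct, iterateFrobenius_def, Algebra.smul_def, mul_comm]
        using this
    intro i
    exact (algebraMap K Ω).injective (by simpa using congrFun h0 i)
  have : Nonempty X := ⟨x⟩
  let b := basisOfLinearIndependentOfCardEqFinrank hli hf.card_eq
  rw [← b.sum_repr v, map_sum]
  refine sum_mem fun i _ => ?_
  rw [map_smul]
  refine (separableClosure K Ω).smul_mem ?_
  simpa [b] using hsep x i

/-- Separability is needed because the fixed field of the whole group may be purely inseparable over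
K. Automorphisms of the separable closure lift to Ω, so infinite Galois theory applies to the
separable closure. -/
theorem exists_algebraMap_eq_of_fixed [Normal K Ω] {z : Ω}
    (hz : z ∈ separableClosure K Ω) (hfix : ∀ g : Gal(Ω/K), g z = z) :
    ∃ k : K, algebraMap K Ω k = z := by
  have hmem : (⟨z, hz⟩ : separableClosure K Ω) ∈
      (⊥ : IntermediateField K (separableClosure K Ω)) := by
    rw [InfiniteGalois.mem_bot_iff_fixed]
    intro g
    have := AlgEquiv.liftNormal_commutes g Ω ⟨z, hz⟩
    exact Subtype.ext (this.symm.trans (hfix _))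
  obtain ⟨k, hk⟩ := IntermediateField.mem_bot.1 hmem
  exact ⟨k, congrArg Subtype.val hk⟩

/-- The coordinates of F with respect to a basis of E solve an invertible linear system over the
separable closure. Galois permutes the equations of the system, so uniqueness makes the coordinates
invariant, hence elements of K. -/
theorem SplittingFamily.exists_descent [Normal K Ω] (p : ℕ) [Fact p.Prime]
    [CharP K p] {f : X → (E →ₐ[K] Ω)} (hf : SplittingFamily f) {F : X → Ω}
    (hF : ∀ x, F x ∈ separableClosure K Ω)
    (hg : ∀ (g : Gal(Ω/K)) x, ∃ y, (∀ v, g (f y v) = f x v) ∧ g (F y) = F x) :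
    ∃ v, ∀ x, f x v = F x := by
  let f' : X → (E →ₐ[K] separableClosure K Ω) := fun x =>
    (f x).codRestrict (separableClosure K Ω).toSubalgebra (hf.mem_separableClosure p x)
  have hf' : SplittingFamily f' :=
    ⟨hf.finite, fun x y h => hf.injective (AlgHom.ext fun v =>
      congrArg Subtype.val (DFunLike.congr_fun h v)), hf.card_eq⟩
  let e := hf.basis
  obtain ⟨s, hs⟩ := hf'.exists_eq_sum e fun x => ⟨F x, hF x⟩
  have hs' : ∀ x, F x = ∑ i, (s i : Ω) * f x (e i) := fun x => by
    have := congrArg (separableClosure K Ω).val (hs x)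
    rw [map_sum] at this
    exact this
  have hfix : ∀ i, ∃ k : K, algebraMap K Ω k = s i := by
    intro i
    refine exists_algebraMap_eq_of_fixed (s i).2 fun g => ?_
    have : (fun i => g (s i : Ω)) = fun i => (s i : Ω) := by
      refine hf.coeff_unique e fun x => ?_
      obtain ⟨y, hy, hy'⟩ := hg g x
      rw [← hs', ← hy', hs' y, map_sum]
      exact Finset.sum_congr rfl fun j _ => by rw [map_mul, hy]
    exact congrFun this i
  choose k hk using hfix
  refine ⟨∑ i, k i • e i, fun x => ?_⟩
  rw [hs', map_sum]
  exact Finset.sum_congr rfl fun i _ => by rw [map_smul, Algebra.smul_def, hk]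

/-- An algebra with a family of points that is compatible with a splitting family of points of `E`
for the Galois action maps to `E`. -/
theorem SplittingFamily.exists_algHom [Normal K Ω] (p : ℕ) [Fact p.Prime]
    [CharP K p] {f : X → (E →ₐ[K] Ω)} (hf : SplittingFamily f)
    {E' : Type*} [CommRing E'] [Algebra K E'] (f' : X → (E' →ₐ[K] Ω))
    (hsep : ∀ x v, f' x v ∈ separableClosure K Ω)
    (hg : ∀ (g : Gal(Ω/K)) x, ∃ y, (∀ v, g (f y v) = f x v) ∧ ∀ v, g (f' y v) = f' x v) :
    ∃ h : E' →ₐ[K] E, ∀ x v, f x (h v) = f' x v := by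
  have h1 : ∀ v : E', ∃ w : E, ∀ x, f x w = f' x v := fun v =>
    hf.exists_descent p (fun x => hsep x v) fun g x => by
      obtain ⟨y, hy, hy'⟩ := hg g x
      exact ⟨y, hy, hy' v⟩
  choose h hh using h1
  refine ⟨AlgHom.ofLinearMap
    { toFun := h
      map_add' := fun v w => hf.ext_points fun x => by simp [hh]
      map_smul' := fun c v => hf.ext_points fun x => by simp [hh] }
    (hf.ext_points fun x => by simp [hh])
    (fun v w => hf.ext_points fun x => by simp [hh]), fun x v => hh v x⟩

end GaloisDescent

/-- The element of `H ⊗ H` underlying a twist. -/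
abbrev twistElem {K H : Type*} [CommRing K] [CommRing H] [Bialgebra K H] (J : twistGroup K H) :
    H ⊗[K] H :=
  ((J : (H ⊗[K] H)ˣ) : H ⊗[K] H)

/-! ### Twists as 2-cocycles on characters -/

section EvalPair

open MonoidAlgebra

variable {K A : Type*} [Field K] [CommGroup A]
  {S T : Type*} [CommRing S] [Algebra K S] [CommRing T] [Algebra K T]

/-- The value of an element of `K[A] ⊗ K[A]` at a pair of `S`-valued characters of `A`. -/
def evalPair (K : Type*) [Field K] [Algebra K S] (χ ψ : A →* S) :
    MonoidAlgebra K A ⊗[K] MonoidAlgebra K A →ₐ[K] S :=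
  Algebra.TensorProduct.productMap (lift K S A χ) (lift K S A ψ)

/-- The value of an element of `K[A] ⊗ K[A] ⊗ K[A]` at a triple of `S`-valued characters of `A`. -/
def evalTriple (K : Type*) [Field K] [Algebra K S] (χ ψ ω : A →* S) :
    MonoidAlgebra K A ⊗[K] (MonoidAlgebra K A ⊗[K] MonoidAlgebra K A) →ₐ[K] S :=
  Algebra.TensorProduct.productMap (lift K S A χ) (evalPair K ψ ω)

@[simp]
theorem evalPair_tmul (χ ψ : A →* S) (x y : MonoidAlgebra K A) :
    evalPair K χ ψ (x ⊗ₜ y) = lift K S A χ x * lift K S A ψ y := rfl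

@[simp]
theorem evalTriple_tmul (χ ψ ω : A →* S) (x : MonoidAlgebra K A)
    (y : MonoidAlgebra K A ⊗[K] MonoidAlgebra K A) :
    evalTriple K χ ψ ω (x ⊗ₜ y) = lift K S A χ x * evalPair K ψ ω y := rfl

theorem map_evalPair (θ : S →ₐ[K] T) (χ ψ : A →* S)
    (y : MonoidAlgebra K A ⊗[K] MonoidAlgebra K A) :
    θ (evalPair K χ ψ y) =
      evalPair K ((θ : S →* T).comp χ) ((θ : S →* T).comp ψ) y := by
  have : θ.comp (evalPair K χ ψ) =
      evalPair K ((θ : S →* T).comp χ) ((θ : S →* T).comp ψ) := by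
    ext a <;> simp
  exact DFunLike.congr_fun this y

theorem evalPair_comm (χ ψ : A →* S) (y : MonoidAlgebra K A ⊗[K] MonoidAlgebra K A) :
    evalPair K χ ψ (Algebra.TensorProduct.comm K _ _ y) = evalPair K ψ χ y := by
  have : (evalPair K χ ψ).comp (Algebra.TensorProduct.comm K _ _).toAlgHom =
      evalPair K ψ χ := by
    ext a <;> simp
  exact DFunLike.congr_fun this y

theorem evalPair_comul (χ ψ : A →* S) (x : MonoidAlgebra K A) :
    evalPair K χ ψ (Coalgebra.comul (R := K) x) = lift K S A (χ * ψ) x := by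
  have : (evalPair K χ ψ).comp (Bialgebra.comulAlgHom K _) = lift K S A (χ * ψ) := by
    ext a; simp
  exact DFunLike.congr_fun this x

theorem evalTriple_comulLeft (χ ψ ω : A →* S)
    (y : MonoidAlgebra K A ⊗[K] MonoidAlgebra K A) :
    evalTriple K χ ψ ω (comulLeft K _ y) = evalPair K (χ * ψ) ω y := by
  have : (evalTriple K χ ψ ω).comp (comulLeft K _) = evalPair K (χ * ψ) ω := by
    ext a <;> simp [comulLeft, Algebra.TensorProduct.one_def]
  exact DFunLike.congr_fun this y

theorem evalTriple_comulRight (χ ψ ω : A →* S)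
    (y : MonoidAlgebra K A ⊗[K] MonoidAlgebra K A) :
    evalTriple K χ ψ ω (comulRight K _ y) = evalPair K χ (ψ * ω) y := by
  have : (evalTriple K χ ψ ω).comp (comulRight K _) = evalPair K χ (ψ * ω) := by
    ext a <;> simp [comulRight]
  exact DFunLike.congr_fun this y

theorem evalTriple_inclLeft (χ ψ ω : A →* S)
    (y : MonoidAlgebra K A ⊗[K] MonoidAlgebra K A) :
    evalTriple K χ ψ ω (inclLeft K _ y) = evalPair K χ ψ y := by
  have : (evalTriple K χ ψ ω).comp (inclLeft K _) = evalPair K χ ψ := by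
    ext a <;> simp [inclLeft]
  exact DFunLike.congr_fun this y

theorem evalTriple_inclRight (χ ψ ω : A →* S)
    (y : MonoidAlgebra K A ⊗[K] MonoidAlgebra K A) :
    evalTriple K χ ψ ω (inclRight K _ y) = evalPair K ψ ω y := by
  simp [inclRight]

theorem evalPair_one_left (ψ : A →* S)
    (y : MonoidAlgebra K A ⊗[K] MonoidAlgebra K A) :
    evalPair K 1 ψ y =
      Algebra.TensorProduct.productMap (Algebra.ofId K S) (lift K S A ψ) (counitLeft K _ y) := by
  have : evalPair K 1 ψ = (Algebra.TensorProduct.productMap (Algebra.ofId K S)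
      (lift K S A ψ)).comp (counitLeft K _) := by
    ext a <;> simp [counitLeft]
  exact DFunLike.congr_fun this y

theorem evalPair_one_right (ψ : A →* S)
    (y : MonoidAlgebra K A ⊗[K] MonoidAlgebra K A) :
    evalPair K ψ 1 y =
      Algebra.TensorProduct.productMap (lift K S A ψ) (Algebra.ofId K S) (counitRight K _ y) := by
  have : evalPair K ψ 1 = (Algebra.TensorProduct.productMap (lift K S A ψ)
      (Algebra.ofId K S)).comp (counitRight K _) := by
    ext a <;> simp [counitRight]
  exact DFunLike.congr_fun this y

variable (J : twistGroup K (MonoidAlgebra K A))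

theorem twist_cocycle (χ ψ ω : A →* S) :
    evalPair K (χ * ψ) ω (twistElem J) * evalPair K χ ψ (twistElem J) =
      evalPair K χ (ψ * ω) (twistElem J) * evalPair K ψ ω (twistElem J) := by
  have := congrArg (evalTriple K χ ψ ω) J.2.1
  rwa [map_mul, map_mul, evalTriple_comulLeft, evalTriple_comulRight, evalTriple_inclLeft,
    evalTriple_inclRight] at this

theorem twist_one_left (ψ : A →* S) : evalPair K 1 ψ (twistElem J) = 1 := by
  rw [evalPair_one_left, J.2.2.1, map_one]

theorem twist_one_right (ψ : A →* S) : evalPair K ψ 1 (twistElem J) = 1 := by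
  rw [evalPair_one_right, J.2.2.2, map_one]

end EvalPair

/-! ### Universal characters detect equality of tensors -/

section Universal

open MonoidAlgebra

variable (K A R : Type*) [Field K] [CommGroup A] [CommRing R] [Algebra K R]

/-- The first of the two universal characters of `A` with values in `R[A × A]`. -/
def univFst (R A : Type*) [CommGroup A] [CommRing R] : A →* MonoidAlgebra R (A × A) :=
  (of R (A × A)).comp (MonoidHom.inl A A)

/-- The second of the two universal characters of `A` with values in `R[A × A]`. -/
def univSnd (R A : Type*) [CommGroup A] [CommRing R] : A →* MonoidAlgebra R (A × A) :=
  (of R (A × A)).comp (MonoidHom.inr A A)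

@[simp]
theorem univFst_apply (a : A) : univFst R A a = single (a, 1) 1 := rfl

@[simp]
theorem univSnd_apply (a : A) : univSnd R A a = single (1, a) 1 := rfl

variable {K A R}

theorem evalPair_univ (y : MonoidAlgebra K A ⊗[K] MonoidAlgebra K A) :
    evalPair K (univFst R A) (univSnd R A) y =
      mapRingHom (A × A) (algebraMap K R) (tensorEquiv K y) := by
  induction y with
  | zero => simp
  | add y z hy hz => simp only [map_add, hy, hz]
  | tmul x y =>
    induction x using MonoidAlgebra.induction_linear with
    | zero => simp
    | add x z hx hz => simp only [TensorProduct.add_tmul, map_add, hx, hz]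
    | single a r =>
      induction y using MonoidAlgebra.induction_linear with
      | zero => simp
      | add x z hx hz => simp only [TensorProduct.tmul_add, map_add, hx, hz]
      | single b s => simp [single_mul_single, Algebra.smul_def]

theorem evalPair_univ_injective [Nontrivial R] :
    Function.Injective (evalPair K (univFst R A) (univSnd R A)) := by
  intro y z h
  rw [evalPair_univ, evalPair_univ] at h
  exact (tensorEquiv K).injective (map_injective _ (algebraMap K R).injective h)

theorem evalTriple_univ
    (y : MonoidAlgebra K A ⊗[K] (MonoidAlgebra K A ⊗[K] MonoidAlgebra K A)) :
    evalTriple K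
      ((of R (A × (A × A))).comp (MonoidHom.inl A (A × A)))
      ((of R (A × (A × A))).comp ((MonoidHom.inr A (A × A)).comp (MonoidHom.inl A A)))
      ((of R (A × (A × A))).comp ((MonoidHom.inr A (A × A)).comp (MonoidHom.inr A A))) y =
      mapRingHom (A × (A × A)) (algebraMap K R)
        (tensorEquiv K (TensorProduct.congr (LinearEquiv.refl K _) (tensorEquiv K) y)) := by
  induction y with
  | zero => simp
  | add y z hy hz => simp only [map_add, hy, hz]
  | tmul x y =>
    induction y with
    | zero => simp
    | add y z hy hz => simp only [TensorProduct.tmul_add, map_add, hy, hz]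
    | tmul y z =>
      induction x using MonoidAlgebra.induction_linear with
      | zero => simp
      | add x z hx hz => simp only [TensorProduct.add_tmul, map_add, hx, hz]
      | single a r =>
        induction y using MonoidAlgebra.induction_linear with
        | zero => simp
        | add x z hx hz =>
          simp only [TensorProduct.tmul_add, TensorProduct.add_tmul, map_add, hx, hz]
        | single b s =>
          induction z using MonoidAlgebra.induction_linear with
          | zero => simp
          | add x z hx hz => simp only [TensorProduct.tmul_add, map_add, hx, hz]
          | single c t => simp [single_mul_single, Algebra.smul_def]

theorem evalTriple_univ_injective [Nontrivial R] :
    Function.Injective (evalTriple K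
      ((of R (A × (A × A))).comp (MonoidHom.inl A (A × A)))
      ((of R (A × (A × A))).comp ((MonoidHom.inr A (A × A)).comp (MonoidHom.inl A A)))
      ((of R (A × (A × A))).comp ((MonoidHom.inr A (A × A)).comp (MonoidHom.inr A A)))) := by
  intro y z h
  rw [evalTriple_univ, evalTriple_univ] at h
  exact (TensorProduct.congr (LinearEquiv.refl K _) (tensorEquiv K)).injective
    ((tensorEquiv K).injective (map_injective _ (algebraMap K R).injective h))

end Universal

/-! ### Symmetry of twists -/

section Symmetry

open MonoidAlgebra

variable {K A : Type*} [Field K] [CommGroup A] (J : twistGroup K (MonoidAlgebra K A))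

/-- The ratio of a twist and its flip. -/
def flipRatio : MonoidAlgebra K A ⊗[K] MonoidAlgebra K A :=
  (twistElem J) *
    Algebra.TensorProduct.comm K _ _ (twistElem J⁻¹)

theorem flipRatio_mul_comm :
    flipRatio J * Algebra.TensorProduct.comm K _ _ (twistElem J) =
      (twistElem J) := by
  have h : twistElem J⁻¹ * twistElem J = 1 :=
    (J : (MonoidAlgebra K A ⊗[K] MonoidAlgebra K A)ˣ).inv_mul
  rw [flipRatio, mul_assoc, ← map_mul, h, map_one, mul_one]

variable {S : Type*} [CommRing S] [Algebra K S]

theorem evalPair_flipRatio_mul (χ ψ : A →* S) :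
    evalPair K χ ψ (flipRatio J) * evalPair K ψ χ (twistElem J) =
      evalPair K χ ψ (twistElem J) := by
  rw [← evalPair_comm χ ψ, ← map_mul, flipRatio_mul_comm]

theorem isUnit_evalPair (χ ψ : A →* S) : IsUnit (evalPair K χ ψ (twistElem J)) :=
  (J : (MonoidAlgebra K A ⊗[K] MonoidAlgebra K A)ˣ).isUnit.map _

theorem evalPair_flipRatio_one_left (ψ : A →* S) : evalPair K 1 ψ (flipRatio J) = 1 := by
  have := evalPair_flipRatio_mul J 1 ψ
  rwa [twist_one_left, twist_one_right, mul_one] at this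

/-- The ratio of a twist and its flip is a bicharacter. -/
theorem evalPair_flipRatio_mul_right (χ ψ ω : A →* S) :
    evalPair K χ (ψ * ω) (flipRatio J) =
      evalPair K χ ψ (flipRatio J) * evalPair K χ ω (flipRatio J) := by
  -- The cocycle identity for three orders of the arguments; combining them is the classical
  -- computation that the antisymmetrization of a 2-cocycle is bimultiplicative.
  have h1 := twist_cocycle J χ ψ ω
  have h2 := twist_cocycle J ψ χ ω
  have h3 := twist_cocycle J ψ ω χ
  rw [mul_comm ψ χ] at h2
  rw [mul_comm ω χ] at h3
  have r1 := evalPair_flipRatio_mul J χ (ψ * ω)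
  have r2 := evalPair_flipRatio_mul J χ ψ
  have r3 := evalPair_flipRatio_mul J χ ω
  set j : (A →* S) → (A →* S) → S := fun χ ψ => evalPair K χ ψ (twistElem J) with hj
  have hu : ∀ χ ψ, IsUnit (j χ ψ) := fun χ ψ => isUnit_evalPair J χ ψ
  change j (χ * ψ) ω * j χ ψ = j χ (ψ * ω) * j ψ ω at h1
  change j (χ * ψ) ω * j ψ χ = j ψ (χ * ω) * j χ ω at h2
  change j (ψ * ω) χ * j ψ ω = j ψ (χ * ω) * j ω χ at h3
  change _ * j (ψ * ω) χ = j χ (ψ * ω) at r1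
  change _ * j ψ χ = j χ ψ at r2
  change _ * j ω χ = j χ ω at r3
  set a := evalPair K χ (ψ * ω) (flipRatio J)
  set b := evalPair K χ ψ (flipRatio J)
  set c := evalPair K χ ω (flipRatio J)
  rw [← r1, ← r2] at h1
  rw [← r3] at h2
  have key : (j (ψ * ω) χ * j ψ ω * j ψ χ) * a = (j (ψ * ω) χ * j ψ ω * j ψ χ) * (b * c) := by
    calc _ = (a * j (ψ * ω) χ * j ψ ω) * j ψ χ := by ring
      _ = (j (χ * ψ) ω * j ψ χ) * (b * j ψ χ) := by rw [← h1]; ring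
      _ = (j ψ (χ * ω) * j ω χ) * (b * c * j ψ χ) := by rw [h2]; ring
      _ = _ := by rw [← h3]; ring
  exact (((hu _ _).mul (hu _ _)).mul (hu _ _)).mul_left_cancel key

/-- The two expressions of an element of `K[A] ⊗ K[A]` through its `K[A]`-valued coefficients. -/
theorem evalPair_eq_mapDomain {M : Type*} [CommGroup M] (i : A →* M)
    (y : MonoidAlgebra K A ⊗[K] MonoidAlgebra K A) :
    evalPair K ((singleOneRingHom : _ →+* MonoidAlgebra (MonoidAlgebra K A) M).toMonoidHom.comp
        (of K A)) ((of (MonoidAlgebra K A) M).comp i) y =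
      mapDomainRingHom (MonoidAlgebra K A) i
        (evalPair K ((singleOneRingHom : _ →+* MonoidAlgebra (MonoidAlgebra K A) A).toMonoidHom.comp
        (of K A)) (of (MonoidAlgebra K A) A) y) := by
  induction y with
  | zero => simp
  | add y z hy hz => simp only [map_add, hy, hz]
  | tmul x y =>
    induction x using MonoidAlgebra.induction_linear with
    | zero => simp
    | add x z hx hz => simp only [TensorProduct.add_tmul, map_add, hx, hz]
    | single a r =>
      induction y using MonoidAlgebra.induction_linear with
      | zero => simp
      | add x z hx hz => simp only [TensorProduct.tmul_add, map_add, hx, hz]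
      | single b s => simp [single_mul_single]

theorem coeff_mapDomain_inl_mul_mapDomain_inr {R : Type*} [CommRing R]
    (x y : MonoidAlgebra R A) (a b : A) :
    (mapDomainRingHom R (MonoidHom.inl A A) x * mapDomainRingHom R (MonoidHom.inr A A) y).coeff
      (a, b) = x.coeff a * y.coeff b := by
  classical
  induction x using MonoidAlgebra.induction_linear with
  | zero => simp
  | add x z hx hz => simp only [map_add, add_mul, coeff_add, Finsupp.add_apply, hx, hz]
  | single a' r =>
    induction y using MonoidAlgebra.induction_linear with
    | zero => simp
    | add x z hx hz => simp only [map_add, mul_add, coeff_add, Finsupp.add_apply, hx, hz]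
    | single b' s =>
      simp only [mapDomainRingHom_apply, mapDomain_single, single_mul_single, coeff_single,
        Finsupp.single_apply, MonoidHom.inl_apply, MonoidHom.inr_apply, Prod.mk_mul_mk, mul_one,
        one_mul, Prod.mk.injEq]
      split_ifs <;> simp_all

theorem evalPair_eq_scalarTensorEquiv (y : MonoidAlgebra K A ⊗[K] MonoidAlgebra K A) :
    evalPair K ((singleOneRingHom : _ →+* MonoidAlgebra (MonoidAlgebra K A) A).toMonoidHom.comp
        (of K A)) (of (MonoidAlgebra K A) A) y = scalarTensorEquiv K (MonoidAlgebra K A) y := by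
  induction y with
  | zero => simp
  | add y z hy hz => simp only [map_add, hy, hz]
  | tmul x y =>
    induction x using MonoidAlgebra.induction_linear with
    | zero => simp
    | add x z hx hz => simp only [TensorProduct.add_tmul, map_add, hx, hz]
    | single a r =>
      induction y using MonoidAlgebra.induction_linear with
      | zero => simp
      | add x z hx hz => simp only [TensorProduct.tmul_add, map_add, hx, hz]
      | single b s =>
        simp [single_mul_single, Algebra.ofId_apply, mul_comm]

/-- Twists of the group algebra of an abelian `p`-group in characteristic `p` are symmetric. -/
theorem twist_symmetric (p n : ℕ) [Fact p.Prime] [CharP K p] (hA : ∀ a : A, a ^ p ^ n = 1) :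
    Algebra.TensorProduct.comm K _ _ (twistElem J) = twistElem J := by
  suffices h : flipRatio J = 1 by simpa [h] using flipRatio_mul_comm J
  apply (scalarTensorEquiv K (MonoidAlgebra K A) (M := A)).injective
  rw [map_one]
  set ρ := scalarTensorEquiv K (MonoidAlgebra K A) (flipRatio J) with hρ
  -- Multiplicativity in the second variable: over the coefficient ring K[A], the element `ρ` is
  -- sent by the diagonal to ρ ⊗ ρ.
  have hmul : mapDomainRingHom (MonoidAlgebra K A) ((MonoidHom.id A).prod (MonoidHom.id A)) ρ =
      mapDomainRingHom _ (MonoidHom.inl A A) ρ * mapDomainRingHom _ (MonoidHom.inr A A) ρ := by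
    rw [hρ, ← evalPair_eq_scalarTensorEquiv, ← evalPair_eq_mapDomain, ← evalPair_eq_mapDomain,
      ← evalPair_eq_mapDomain, ← evalPair_flipRatio_mul_right]
    congr 2
    ext a
    simp [single_mul_single]
  have hidem : ∀ b, IsIdempotentElem (ρ.coeff b) := by
    intro b
    -- At the diagonal entry (b, b) one side has coefficient ρ_b and the other ρ_b².
    have h := congrArg (fun z => z.coeff (b, b)) hmul
    simp only [coeff_mapDomain_inl_mul_mapDomain_inr] at h
    rw [IsIdempotentElem, ← h]
    exact Finsupp.mapDomain_apply (f := ((MonoidHom.id A).prod (MonoidHom.id A)))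
      (fun x y hxy => congrArg Prod.fst hxy) _ b
  -- Augmenting the coefficients replaces the first character by the trivial one, where a
  -- bicharacter is 1.
  have hone : mapRingHom A (augmentation K A : MonoidAlgebra K A →+* K) ρ = 1 := by
    have := map_evalPair (mapAlgHom A (augmentation K A))
      ((singleOneRingHom : _ →+* MonoidAlgebra (MonoidAlgebra K A) A).toMonoidHom.comp (of K A))
      (of (MonoidAlgebra K A) A) (flipRatio J)
    rw [evalPair_eq_scalarTensorEquiv] at this
    have e : (mapAlgHom A (augmentation K A) : MonoidAlgebra (MonoidAlgebra K A) A →*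
        MonoidAlgebra K A).comp ((singleOneRingHom : _ →+* MonoidAlgebra (MonoidAlgebra K A)
          A).toMonoidHom.comp (of K A)) = 1 := by
      ext a
      simp [one_def]
    rw [e, evalPair_flipRatio_one_left] at this
    exact this
  refine coeff_injective (Finsupp.ext fun b => ?_)
  rw [MonoidAlgebra.eq_algebraMap_of_idempotent p n hA (hidem b)]
  have h := congrArg (fun z => z.coeff b) hone
  simp only [coeff_mapRingHom, RingHom.coe_coe] at h
  rw [h, one_def, one_def]
  by_cases hb : b = 1
  · subst hb; simp [one_def]
  · simp [Ne.symm hb]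

end Symmetry

/-! ### Points of the twisted dual as trivializations of the twist -/

section DualPoints

open MonoidAlgebra

variable {K A Ω : Type*} [Field K] [CommGroup A] [Field Ω] [Algebra K Ω]

/-- The linear extension to `R[M]` of a function on `M`. -/
def pairing {R M : Type*} [CommRing R] (u : M → R) : MonoidAlgebra R M →ₗ[R] R :=
  Finsupp.linearCombination R u ∘ₗ (coeffLinearEquiv R).toLinearMap

@[simp]
theorem pairing_single {R M : Type*} [CommRing R] (u : M → R) (m : M) (r : R) :
    pairing u (single m r) = r * u m := by
  simp [pairing]

theorem pairing_add {R M : Type*} [CommRing R] (u v : M → R) (x : MonoidAlgebra R M) :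
    pairing (u + v) x = pairing u x + pairing v x := by
  induction x using MonoidAlgebra.induction_linear with
  | zero => simp
  | add x y hx hy => rw [map_add, hx, hy, map_add, map_add]; ring
  | single a r => simp [mul_add]

theorem pairing_smul {R M : Type*} [CommRing R] (c : R) (u : M → R) (x : MonoidAlgebra R M) :
    pairing (c • u) x = c * pairing u x := by
  induction x using MonoidAlgebra.induction_linear with
  | zero => simp
  | add x y hx hy => rw [map_add, hx, hy, map_add, mul_add]
  | single a r => simp; ring

theorem pairing_pi_single {R M : Type*} [CommRing R] [DecidableEq M] (m : M)
    (x : MonoidAlgebra R M) : pairing (Pi.single m 1) x = x.coeff m := by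
  induction x using MonoidAlgebra.induction_linear with
  | zero => simp
  | add x y hx hy => rw [map_add, hx, hy]; simp
  | single a r => simp [Finsupp.single_apply, Pi.single_apply]

theorem pairing_one {R A : Type*} [CommRing R] [CommGroup A] (x : MonoidAlgebra R A) :
    pairing (fun _ => 1) x = augmentation R A x := by
  induction x using MonoidAlgebra.induction_linear with
  | zero => simp
  | add x y hx hy => rw [map_add, hx, hy, map_add]
  | single a r => simp

theorem pairing_mul_single {R A : Type*} [CommRing R] [CommGroup A] (u : A → R) (c : A)
    (x : MonoidAlgebra R A) : pairing u (x * single c 1) = pairing (fun a => u (a * c)) x := by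
  induction x using MonoidAlgebra.induction_linear with
  | zero => simp
  | add x y hx hy => rw [add_mul, map_add, hx, hy, map_add]
  | single a r => simp [single_mul_single]

theorem map_pairing {R S M : Type*} [CommRing R] [CommRing S] (g : R →+* S) (u : M → R)
    (x : MonoidAlgebra R M) [Monoid M] :
    g (pairing u x) = pairing (fun a => g (u a)) (mapRingHom M g x) := by
  induction x using MonoidAlgebra.induction_linear with
  | zero => simp
  | add x y hx hy => simp only [map_add, hx, hy]
  | single a r => simp

theorem pairing_mul_pairing {R A : Type*} [CommRing R] [CommGroup A] (u v : A → R)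
    (x y : MonoidAlgebra R A) :
    pairing u x * pairing v y = pairing (fun a : A × A => u a.1 * v a.2)
      (lift R (MonoidAlgebra R (A × A)) A (univFst R A) x *
        lift R (MonoidAlgebra R (A × A)) A (univSnd R A) y) := by
  induction x using MonoidAlgebra.induction_linear with
  | zero => simp
  | add x z hx hz => rw [map_add, map_add, add_mul, add_mul, map_add, hx, hz]
  | single a r =>
    induction y using MonoidAlgebra.induction_linear with
    | zero => simp
    | add x z hx hz => rw [map_add, map_add, mul_add, mul_add, map_add, hx, hz]
    | single b s => simp [single_mul_single]; ring

theorem pairing_lift_mul {R A M : Type*} [CommRing R] [CommGroup A] [CommGroup M] (w : M → R)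
    (χ : A →* MonoidAlgebra R M) (z : MonoidAlgebra R M) (x : MonoidAlgebra R A) :
    pairing w (lift R (MonoidAlgebra R M) A χ x * z) =
      pairing (fun a => pairing w (χ a * z)) x := by
  induction x using MonoidAlgebra.induction_linear with
  | zero => simp
  | add x y hx hy => simp only [map_add, add_mul, hx, hy]
  | single a r => simp

variable (J : twistGroup K (MonoidAlgebra K A))

/-- An element of the twisted dual, as a function on the group. -/
def dualEquiv : TwistedDual J ≃ₗ[K] (A → K) :=
  (WithConv.linearEquiv K (MonoidAlgebra K A →ₗ[K] K)).trans
    ((MonoidAlgebra.basis A K).constr K).symm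

theorem dualEquiv_one (a : A) : dualEquiv J 1 a = 1 := by
  change Coalgebra.counit (R := K) (single a 1 : MonoidAlgebra K A) = 1
  simp

theorem dualEquiv_dualAction (c : A) (f : TwistedDual J) (a : A) :
    dualEquiv J (dualAction J c f) a = dualEquiv J f (a * c) := by
  change f.ofConv ((single a 1 : MonoidAlgebra K A) * of K A c) = _
  rw [of_apply, single_mul_single, mul_one]
  rfl

theorem algebraMap_mul'_map (φ ψ : MonoidAlgebra K A →ₗ[K] K)
    (y : MonoidAlgebra K A ⊗[K] MonoidAlgebra K A) :
    algebraMap K Ω (LinearMap.mul' K K (TensorProduct.map φ ψ y)) =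
      pairing (fun a : A × A => algebraMap K Ω (φ (single a.1 1) * ψ (single a.2 1)))
        (evalPair K (univFst Ω A) (univSnd Ω A) y) := by
  have hs : ∀ (φ : MonoidAlgebra K A →ₗ[K] K) (a : A) (r : K),
      φ (single a r) = r * φ (single a 1) := by
    intro φ a r
    rw [← smul_eq_mul, ← map_smul, smul_single, smul_eq_mul, mul_one]
  rw [evalPair_univ]
  induction y with
  | zero => simp
  | add y z hy hz => simp only [map_add, hy, hz]
  | tmul x y =>
    induction x using MonoidAlgebra.induction_linear with
    | zero => simp
    | add x z hx hz => simp only [TensorProduct.add_tmul, map_add, hx, hz]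
    | single a r =>
      induction y using MonoidAlgebra.induction_linear with
      | zero => simp
      | add x z hx hz => simp only [TensorProduct.tmul_add, map_add, hx, hz]
      | single b s =>
        simp only [TensorProduct.map_tmul, LinearMap.mul'_apply, tensorEquiv_single_tmul_single,
          mapRingHom_single, pairing_single, map_mul, hs φ a r, hs ψ b s]
        ring

theorem algebraMap_mul'_map_comul (φ ψ : MonoidAlgebra K A →ₗ[K] K)
    (z : MonoidAlgebra K A ⊗[K] MonoidAlgebra K A) (a : A) :
    algebraMap K Ω (LinearMap.mul' K K (TensorProduct.map φ ψ
        (Coalgebra.comul (R := K) (single a 1 : MonoidAlgebra K A) * z))) =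
      pairing (fun a : A × A => algebraMap K Ω (φ (single a.1 1)) *
          algebraMap K Ω (ψ (single a.2 1)))
        ((univFst Ω A * univSnd Ω A) a * evalPair K (univFst Ω A) (univSnd Ω A) z) := by
  rw [algebraMap_mul'_map, map_mul (evalPair (A := A) K _ _), evalPair_comul, lift_single, one_smul]
  simp only [map_mul (algebraMap K Ω)]

/-- The linear form on the twisted dual given by an element of `Ω[A]`. -/
def pointMap (x : MonoidAlgebra Ω A) : TwistedDual J →ₗ[K] Ω where
  toFun f := pairing (fun a => algebraMap K Ω (dualEquiv J f a)) x
  map_add' f g := by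
    rw [← pairing_add]; congr 2; ext a; simp
  map_smul' c f := by
    rw [RingHom.id_apply, Algebra.smul_def, ← pairing_smul]; congr 2; ext a; simp

theorem pointMap_apply (x : MonoidAlgebra Ω A) (f : TwistedDual J) :
    pointMap J x f = pairing (fun a => algebraMap K Ω (dualEquiv J f a)) x := rfl

theorem pointMap_one (x : MonoidAlgebra Ω A) : pointMap J x 1 = augmentation Ω A x := by
  rw [pointMap_apply, ← pairing_one]
  congr 2
  ext a
  rw [dualEquiv_one, map_one]

theorem algebraMap_dualEquiv_mul (f g : TwistedDual J) (a : A) :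
    algebraMap K Ω (dualEquiv J (f * g) a) =
      pairing (fun a : A × A => algebraMap K Ω (dualEquiv J f a.1) *
          algebraMap K Ω (dualEquiv J g a.2))
        ((univFst Ω A * univSnd Ω A) a *
          evalPair K (univFst Ω A) (univSnd Ω A) (twistElem J)) :=
  algebraMap_mul'_map_comul f.ofConv g.ofConv (twistElem J) a

/-- Together with `pointMap_mul_pointMap` this writes both sides of multiplicativity as pairings
with the same function on A × A, so that multiplicativity becomes Δ(x) J = x ⊗ x. -/
theorem pointMap_mul (x : MonoidAlgebra Ω A) (f g : TwistedDual J) :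
    pointMap J x (f * g) =
      pairing (fun a : A × A => algebraMap K Ω (dualEquiv J f a.1) *
          algebraMap K Ω (dualEquiv J g a.2))
        (lift Ω (MonoidAlgebra Ω (A × A)) A (univFst Ω A * univSnd Ω A) x *
          evalPair K (univFst Ω A) (univSnd Ω A) (twistElem J)) := by
  rw [pairing_lift_mul, pointMap_apply]
  exact congrArg (pairing · x) (funext (algebraMap_dualEquiv_mul J f g))

theorem pointMap_mul_pointMap (x : MonoidAlgebra Ω A) (f g : TwistedDual J) :
    pointMap J x f * pointMap J x g =
      pairing (fun a : A × A => algebraMap K Ω (dualEquiv J f a.1) *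
          algebraMap K Ω (dualEquiv J g a.2))
        (lift Ω (MonoidAlgebra Ω (A × A)) A (univFst Ω A) x *
          lift Ω (MonoidAlgebra Ω (A × A)) A (univSnd Ω A) x) := by
  rw [pointMap_apply, pointMap_apply, pairing_mul_pairing]

/-- The elements `x` of `Ω[A]` of augmentation one that trivialize the twist `J`, that is,
`Δ(x) J = x ⊗ x`. -/
structure IsTrivialization (x : MonoidAlgebra Ω A) : Prop where
  augmentation_eq : augmentation Ω A x = 1
  comul_mul : lift Ω (MonoidAlgebra Ω (A × A)) A (univFst Ω A * univSnd Ω A) x *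
      evalPair K (univFst Ω A) (univSnd Ω A) (twistElem J) =
    lift Ω (MonoidAlgebra Ω (A × A)) A (univFst Ω A) x *
      lift Ω (MonoidAlgebra Ω (A × A)) A (univSnd Ω A) x

variable {J}

/-- The point of the twisted dual given by a trivialization of the twist. -/
def IsTrivialization.toAlgHom {x : MonoidAlgebra Ω A} (hx : IsTrivialization J x) :
    TwistedDual J →ₐ[K] Ω :=
  AlgHom.ofLinearMap (pointMap J x) (by rw [pointMap_one, hx.augmentation_eq]) fun f g => by
    rw [pointMap_mul, hx.comul_mul, pointMap_mul_pointMap]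

theorem IsTrivialization.toAlgHom_apply {x : MonoidAlgebra Ω A} (hx : IsTrivialization J x)
    (f : TwistedDual J) :
    hx.toAlgHom f = pairing (fun a => algebraMap K Ω (dualEquiv J f a)) x := rfl

/-- Every point of the twisted dual comes from a trivialization. -/
theorem exists_isTrivialization [Finite A] (F : TwistedDual J →ₐ[K] Ω) :
    ∃ (x : MonoidAlgebra Ω A) (hx : IsTrivialization J x), hx.toAlgHom = F := by
  classical
  have := Fintype.ofFinite A
  let x : MonoidAlgebra Ω A := ∑ a, single a (F ((dualEquiv J).symm (Pi.single a 1)))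
  have hF : ∀ f, pointMap J x f = F f := by
    intro f
    rw [pointMap_apply, map_sum]
    simp only [pairing_single]
    have : f = ∑ a, dualEquiv J f a • (dualEquiv J).symm (Pi.single a 1) := by
      apply (dualEquiv J).injective
      rw [map_sum]
      ext b
      simp [Finset.sum_apply, Pi.single_apply]
    conv_rhs => rw [this]
    simp [Algebra.smul_def, mul_comm]
  have hx : IsTrivialization J x := by
    refine ⟨by rw [← pointMap_one J, hF, map_one], ?_⟩
    -- Products of delta functions read off single coefficients, so multiplicativity of F on delta
    -- functions gives the whole identity.
    ext ⟨a, b⟩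
    rw [← pairing_pi_single, ← pairing_pi_single]
    have hu : (Pi.single (a, b) 1 : A × A → Ω) = fun c : A × A => algebraMap K Ω
        (dualEquiv J ((dualEquiv J).symm (Pi.single a 1)) c.1) *
          algebraMap K Ω (dualEquiv J ((dualEquiv J).symm (Pi.single b 1)) c.2) := by
      ext ⟨c, d⟩
      simp only [LinearEquiv.apply_symm_apply, Pi.single_apply, Prod.mk.injEq]
      split_ifs <;> simp_all
    rw [hu, ← pointMap_mul, ← pointMap_mul_pointMap, hF, hF, hF, map_mul]
  exact ⟨x, hx, AlgHom.ext hF⟩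

theorem ext_pairing_dualEquiv {x y : MonoidAlgebra Ω A} (h : ∀ f : TwistedDual J,
    pairing (fun a => algebraMap K Ω (dualEquiv J f a)) x =
      pairing (fun a => algebraMap K Ω (dualEquiv J f a)) y) : x = y := by
  classical
  ext a
  have := h ((dualEquiv J).symm (Pi.single a 1))
  have hu : (fun b => algebraMap K Ω (dualEquiv J ((dualEquiv J).symm (Pi.single a 1)) b)) =
      Pi.single a 1 := by
    ext b
    simp [Pi.single_apply, apply_ite (algebraMap K Ω)]
  rwa [hu, pairing_pi_single, pairing_pi_single] at this

/-- On trivializations, translation of a point by `c` is multiplication of `x` by `c`. -/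
theorem toAlgHom_dualAction {x : MonoidAlgebra Ω A} (hx : IsTrivialization J x) (c : A)
    (f : TwistedDual J) :
    hx.toAlgHom (dualAction J c f) =
      pairing (fun a => algebraMap K Ω (dualEquiv J f a)) (x * single c 1) := by
  rw [hx.toAlgHom_apply, pairing_mul_single]
  simp only [dualEquiv_dualAction]

theorem map_toAlgHom {x : MonoidAlgebra Ω A} (hx : IsTrivialization J x) (g : Ω →ₐ[K] Ω)
    (f : TwistedDual J) :
    g (hx.toAlgHom f) =
      pairing (fun a => algebraMap K Ω (dualEquiv J f a)) (mapRingHom A (g : Ω →+* Ω) x) := by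
  rw [hx.toAlgHom_apply]
  refine (map_pairing (g : Ω →+* Ω) _ x).trans ?_
  simp

end DualPoints

/-! ### The Galois character on the points of an algebra with A-action -/

section TorsorPoints

variable {K A E Ω : Type*} [Field K] [CommGroup A] [CommRing E] [Algebra K E] [Field Ω]
  [Algebra K Ω]

/-- The translate of a point of an algebra with `A`-action. -/
def translatePoint (ρ : A →* (E ≃ₐ[K] E)) (f : E →ₐ[K] Ω) (c : A) : E →ₐ[K] Ω :=
  f.comp (ρ c).toAlgHom

@[simp]
theorem translatePoint_apply (ρ : A →* (E ≃ₐ[K] E)) (f : E →ₐ[K] Ω) (c : A) (v : E) :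
    translatePoint ρ f c v = f (ρ c v) := rfl

theorem translatePoint_translatePoint (ρ : A →* (E ≃ₐ[K] E)) (f : E →ₐ[K] Ω) (c d : A) :
    translatePoint ρ (translatePoint ρ f c) d = translatePoint ρ f (c * d) := by
  ext v; simp

/-- An algebra of dimension d has at most d points, so a splitting family exhausts them. -/
theorem SplittingFamily.surjective {X : Type*} [Fintype X] {f : X → (E →ₐ[K] Ω)}
    (hf : SplittingFamily f) : Function.Surjective f := by
  have := hf.finite
  exact (hf.injective.bijective_of_nat_card_le ((card_algHom_le_finrank K E Ω).trans_eq
    (hf.card_eq.symm.trans Nat.card_eq_fintype_card.symm))).2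

variable [Fintype A]

/-- If the translates of one point split an algebra with `A`-action, so do those of any other. -/
theorem SplittingFamily.translate_any {ρ : A →* (E ≃ₐ[K] E)} {f : E →ₐ[K] Ω}
    (hf : SplittingFamily (translatePoint ρ f)) (f' : E →ₐ[K] Ω) :
    SplittingFamily (translatePoint ρ f') := by
  obtain ⟨d, rfl⟩ := hf.surjective f'
  refine ⟨hf.finite, fun c c' h => ?_, hf.card_eq⟩
  simp only [translatePoint_translatePoint] at h
  exact mul_left_cancel (hf.injective h)

/-- The Galois action on the points of a torsor is given by a continuous character. -/
theorem SplittingFamily.exists_galoisCharacter [Algebra.IsIntegral K Ω] [TopologicalSpace A]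
    [DiscreteTopology A] {ρ : A →* (E ≃ₐ[K] E)} {f : E →ₐ[K] Ω}
    (hf : SplittingFamily (translatePoint ρ f)) :
    ∃ φ : Gal(Ω/K) →ₜ* A, ∀ g x, g (f x) = f (ρ (φ g) x) := by
  have h1 : ∀ g : Gal(Ω/K), ∃ c, ∀ x, g (f x) = f (ρ c x) := fun g => by
    obtain ⟨c, hc⟩ := hf.surjective (g.toAlgHom.comp f)
    exact ⟨c, fun x => (DFunLike.congr_fun hc x).symm⟩
  choose φ hφ using h1
  have huniq : ∀ c d : A, (∀ x, f (ρ c x) = f (ρ d x)) → c = d := fun c d h =>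
    hf.injective (AlgHom.ext h)
  let ψ : Gal(Ω/K) →* A :=
    { toFun := φ
      map_one' := huniq _ _ fun x => by rw [← hφ]; simp
      map_mul' := fun g g' => huniq _ _ fun x => by
        rw [← hφ, AlgEquiv.mul_apply, hφ g', hφ g, map_mul, AlgEquiv.mul_apply] }
  refine ⟨⟨ψ, continuous_of_continuousAt_one ψ ?_⟩, hφ⟩
  rw [ContinuousAt, map_one, nhds_discrete A, Filter.tendsto_pure]
  -- Continuity: the automorphisms fixing the finitely many values of `f` on a basis form a
  -- neighbourhood of 1, and they fix the point `f`.
  have hopen : ∀ i, ∀ᶠ g : Gal(Ω/K) in nhds 1, g (f (hf.basis i)) = f (hf.basis i) := fun i =>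
    (stabilizer_isOpen_of_isIntegral (K := K) (f (hf.basis i))).mem_nhds
      (one_mem (MulAction.stabilizer Gal(Ω/K) (f (hf.basis i))))
  filter_upwards [Filter.eventually_all.2 hopen] with g hg
  refine huniq _ _ fun x => ?_
  have : (f.comp (ρ (φ g)).toAlgHom).toLinearMap = f.toLinearMap :=
    hf.basis.ext fun i => by
      change f (ρ (φ g) _) = f _
      rw [← hφ, hg]
  rw [map_one]
  exact DFunLike.congr_fun this x

end TorsorPoints

/-! ### The character of a torsor determines the torsor -/

namespace ATorsor

variable {K A : Type*} [Field K] [CommGroup A] [Fintype A]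

theorem exists_splittingFamily (B : ATorsor K A) :
    ∃ f : B.carrier →ₐ[K] AlgebraicClosure K, SplittingFamily (translatePoint B.ρ f) := by
  classical
  obtain ⟨φ, hφ⟩ := B.split
  -- The point is evaluation at 1 ∈ A; equivariance makes its translate by `c` evaluation at `c`.
  let f : B.carrier →ₐ[K] AlgebraicClosure K :=
    ((Pi.evalAlgHom K (fun _ : A => AlgebraicClosure K) 1).comp
      (φ.restrictScalars K).toAlgHom).comp Algebra.TensorProduct.includeRight
  have hf : ∀ c x, translatePoint B.ρ f c x = φ (1 ⊗ₜ x) c := fun c x => by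
    have := hφ c 1 1 x
    rwa [one_mul] at this
  have hrank : Fintype.card A = Module.finrank K B.carrier := by
    rw [← Module.finrank_baseChange (R := AlgebraicClosure K), φ.toLinearEquiv.finrank_eq,
      Module.finrank_pi]
  refine ⟨f, Module.finite_of_finrank_pos (hrank ▸ Fintype.card_pos), fun c c' h => ?_, hrank⟩
  have key : ∀ z, φ z c = φ z c' := by
    intro z
    induction z with
    | zero => simp
    | add y z hy hz => rw [map_add, Pi.add_apply, Pi.add_apply, hy, hz]
    | tmul s x =>
      have : s ⊗ₜ[K] x = s • (1 ⊗ₜ[K] x : AlgebraicClosure K ⊗[K] B.carrier) := by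
        rw [TensorProduct.smul_tmul', smul_eq_mul, mul_one]
      rw [this, map_smul, Pi.smul_apply, Pi.smul_apply, ← hf, ← hf, h]
  have := key (φ.symm (Pi.single c 1))
  by_contra hne
  simp [Ne.symm hne] at this

theorem splittingFamily (B : ATorsor K A) (f : B.carrier →ₐ[K] AlgebraicClosure K) :
    SplittingFamily (translatePoint B.ρ f) := by
  obtain ⟨f₀, h⟩ := B.exists_splittingFamily
  exact h.translate_any f

variable [TopologicalSpace A] [DiscreteTopology A]

/-- A point of a torsor over the algebraic closure. -/
def point (B : ATorsor K A) : B.carrier →ₐ[K] AlgebraicClosure K :=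
  B.exists_splittingFamily.choose

/-- The character of the Galois group given by its action on the points of a torsor. -/
def galoisCharacter (B : ATorsor K A) : Gal(AlgebraicClosure K/K) →ₜ* A :=
  (B.splittingFamily B.point).exists_galoisCharacter.choose

/-- The character does not depend on the chosen point: any other point is a translate, and A is
commutative. -/
theorem galoisCharacter_spec (B : ATorsor K A) (f : B.carrier →ₐ[K] AlgebraicClosure K)
    (g : Gal(AlgebraicClosure K/K)) (x : B.carrier) :
    g (f x) = f (B.ρ (B.galoisCharacter g) x) := by
  obtain ⟨d, rfl⟩ := (B.splittingFamily B.point).surjective f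
  rw [translatePoint_apply, translatePoint_apply, galoisCharacter,
    (B.splittingFamily B.point).exists_galoisCharacter.choose_spec, ← AlgEquiv.mul_apply,
    ← AlgEquiv.mul_apply, ← map_mul, ← map_mul, mul_comm]

theorem galoisCharacter_eq (B : ATorsor K A) (f : B.carrier →ₐ[K] AlgebraicClosure K)
    (φ : Gal(AlgebraicClosure K/K) →ₜ* A) (h : ∀ g x, g (f x) = f (B.ρ (φ g) x)) :
    B.galoisCharacter = φ := by
  ext g
  refine (B.splittingFamily f).injective (AlgHom.ext fun x => ?_)
  rw [translatePoint_apply, translatePoint_apply, ← h, galoisCharacter_spec]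

theorem galoisCharacter_eq_of_equivariantIso {B C : ATorsor K A}
    (h : EquivariantIso B.ρ C.ρ) : B.galoisCharacter = C.galoisCharacter := by
  obtain ⟨e, he⟩ := h
  refine B.galoisCharacter_eq (C.point.comp e.toAlgHom) _ fun g x => ?_
  change g (C.point (e x)) = C.point (e _)
  rw [he, galoisCharacter_spec]

/-- Matching the points of B and C by their translation index is compatible with Galois when the
characters agree, so descent gives mutually inverse homomorphisms. -/
theorem equivariantIso_of_galoisCharacter_eq (p : ℕ) [Fact p.Prime] [CharP K p] {B C : ATorsor K A}
    (h : B.galoisCharacter = C.galoisCharacter) : EquivariantIso B.ρ C.ρ := by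
  have main : ∀ {B C : ATorsor K A}, B.galoisCharacter = C.galoisCharacter →
      ∃ e : B.carrier →ₐ[K] C.carrier, ∀ a v, C.point (C.ρ a (e v)) = B.point (B.ρ a v) := by
    intro B C h
    refine (C.splittingFamily C.point).exists_algHom p (translatePoint B.ρ B.point)
      (fun x v => (B.splittingFamily B.point).mem_separableClosure p x v) fun g x =>
        -- Since `g` shifts indices by its character, this is the index that `g` carries to `x`.
        ⟨x * (C.galoisCharacter g)⁻¹, fun v => ?_, fun v => ?_⟩
    · rw [translatePoint_apply, galoisCharacter_spec, ← AlgEquiv.mul_apply, ← map_mul,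
        mul_inv_cancel_comm_assoc, translatePoint_apply]
    · rw [translatePoint_apply, galoisCharacter_spec, ← AlgEquiv.mul_apply, ← map_mul, h,
        mul_inv_cancel_comm_assoc, translatePoint_apply]
  obtain ⟨e, he⟩ := main h
  obtain ⟨e', he'⟩ := main h.symm
  refine ⟨AlgEquiv.ofAlgHom e e' (AlgHom.ext fun v => ?_) (AlgHom.ext fun v => ?_), fun a v => ?_⟩
  · refine (C.splittingFamily C.point).ext_points fun x => ?_
    change C.point (C.ρ x (e (e' v))) = C.point (C.ρ x v)
    rw [he, he']
  · refine (B.splittingFamily B.point).ext_points fun x => ?_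
    change B.point (B.ρ x (e' (e v))) = B.point (B.ρ x v)
    rw [he', he]
  · refine (C.splittingFamily C.point).ext_points fun x => ?_
    change C.point (C.ρ x (e (B.ρ a v))) = C.point (C.ρ x (C.ρ a (e v)))
    rw [he, ← AlgEquiv.mul_apply, ← map_mul, ← AlgEquiv.mul_apply, ← map_mul, he]

end ATorsor

/-! ### The twisted dual is a torsor -/

section DualTorsor

open MonoidAlgebra

universe u v

variable {K : Type u} {A : Type v} [Field K] [CommGroup A]

/-- Symmetry of the twist is what makes the convolution algebra commutative. -/
theorem twistedDual_isCocomm (J : twistGroup K (MonoidAlgebra K A)) (p n : ℕ) [Fact p.Prime]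
    [CharP K p] (hA : ∀ a : A, a ^ p ^ n = 1) :
    Coalgebra.IsCocomm K (TwistedCoalgebra J) where
  comm_comp_comul := by
    have main : ∀ h : MonoidAlgebra K A, TensorProduct.comm K _ _
        (Coalgebra.comul (R := K) h * twistElem J) = Coalgebra.comul (R := K) h * twistElem J := by
      intro h
      have e := map_mul (Algebra.TensorProduct.comm K (MonoidAlgebra K A) (MonoidAlgebra K A))
        (Coalgebra.comul (R := K) h) (twistElem J)
      rw [twist_symmetric J p n hA] at e
      refine e.trans ?_
      congr 1
      exact Coalgebra.comm_comul K h
    exact LinearMap.ext main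

/-- A nonzero finite-dimensional commutative algebra has a point over an algebraically closed
field. -/
theorem nonempty_algHom_of_finite (K E Ω : Type*) [Field K] [CommRing E] [Nontrivial E]
    [Algebra K E] [Module.Finite K E] [Field Ω] [Algebra K Ω] [IsAlgClosed Ω] :
    Nonempty (E →ₐ[K] Ω) := by
  obtain ⟨m, hm⟩ := Ideal.exists_maximal E
  let _ := Ideal.Quotient.field m
  have : Algebra.IsAlgebraic K (E ⧸ m) := Algebra.IsAlgebraic.of_finite K (E ⧸ m)
  exact ⟨(IsAlgClosed.lift : (E ⧸ m) →ₐ[K] Ω).comp (Ideal.Quotient.mkₐ K m)⟩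

theorem IsTrivialization.isUnit (p n : ℕ) [Fact p.Prime] [CharP K p] (hA : ∀ a : A, a ^ p ^ n = 1)
    {Ω : Type*} [Field Ω] [Algebra K Ω] {x : MonoidAlgebra Ω A}
    {J : twistGroup K (MonoidAlgebra K A)} (hx : IsTrivialization J x) : IsUnit x := by
  have : CharP Ω p := charP_of_injective_algebraMap (algebraMap K Ω).injective p
  refine MonoidAlgebra.isUnit_of_isUnit_augmentation p n hA ?_
  rw [hx.augmentation_eq]
  exact isUnit_one

theorem mul_single_one_injective {R : Type*} [CommRing R] [Nontrivial R] {x : MonoidAlgebra R A}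
    (hx : IsUnit x) {a b : A} (h : x * single a 1 = x * single b 1) : a = b :=
  of_injective (hx.mul_left_cancel h)

variable [Fintype A]

theorem finrank_twistedDual (J : twistGroup K (MonoidAlgebra K A)) :
    Module.finrank K (TwistedDual J) = Fintype.card A := by
  rw [(dualEquiv J).finrank_eq, Module.finrank_pi]

instance (J : twistGroup K (MonoidAlgebra K A)) : Module.Finite K (TwistedDual J) :=
  Module.Finite.equiv (dualEquiv J).symm

instance (J : twistGroup K (MonoidAlgebra K A)) : Nontrivial (TwistedDual J) :=
  (dualEquiv J).toEquiv.nontrivial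

/-- An algebra with `A`-action that is split by the translates of a point satisfies the splitting
condition in the definition of a torsor. -/
theorem SplittingFamily.exists_algEquiv {E Ω : Type*} [CommRing E] [Algebra K E] [Field Ω]
    [Algebra K Ω] {ρ : A →* (E ≃ₐ[K] E)} {f : E →ₐ[K] Ω}
    (hf : SplittingFamily (translatePoint ρ f)) :
    ∃ φ : Ω ⊗[K] E ≃ₐ[Ω] (A → Ω), ∀ (a c : A) (s : Ω) (x : E),
      φ (s ⊗ₜ[K] ρ a x) c = φ (s ⊗ₜ[K] x) (c * a) := by
  refine ⟨AlgEquiv.ofBijective (SplittingFamily.evalHom _) hf.evalHom_bijective,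
    fun a c s x => ?_⟩
  simp only [AlgEquiv.coe_ofBijective, SplittingFamily.evalHom_tmul, translatePoint_apply, map_mul,
    AlgEquiv.mul_apply]

theorem exists_trivialization (p n : ℕ) [Fact p.Prime] [CharP K p] (hA : ∀ a : A, a ^ p ^ n = 1)
    (J : twistGroup K (MonoidAlgebra K A)) (Ω : Type*) [Field Ω] [Algebra K Ω] [IsAlgClosed Ω] :
    ∃ x : MonoidAlgebra Ω A, IsTrivialization J x := by
  have := twistedDual_isCocomm J p n hA
  obtain ⟨f⟩ := nonempty_algHom_of_finite K (TwistedDual J) Ω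
  obtain ⟨x, hx, -⟩ := exists_isTrivialization f
  exact ⟨x, hx⟩

/-- The twisted dual as a torsor. -/
def dualTorsor (p n : ℕ) [Fact p.Prime] [CharP K p] (hA : ∀ a : A, a ^ p ^ n = 1)
    (J : twistGroup K (MonoidAlgebra K A)) : ATorsor K A :=
  haveI := twistedDual_isCocomm J p n hA
  -- The translates of a trivialization `x` are distinct because `x` is a unit, and their number |A|
  -- is the dimension of the dual.
  have hs : ∃ f : TwistedDual J →ₐ[K] AlgebraicClosure K,
      SplittingFamily (translatePoint (dualAction J) f) := by
    obtain ⟨x, hx⟩ := exists_trivialization p n hA J (AlgebraicClosure K)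
    refine ⟨hx.toAlgHom, inferInstance, fun c c' h => ?_, (finrank_twistedDual J).symm⟩
    refine mul_single_one_injective (hx.isUnit p n hA)
      (ext_pairing_dualEquiv (J := J) fun f => ?_)
    rw [← toAlgHom_dualAction hx, ← toAlgHom_dualAction hx]
    exact DFunLike.congr_fun h f
  { carrier := TwistedDual J
    ρ := dualAction J
    semisimple := by
      obtain ⟨f, hf⟩ := hs
      have := hf.isReduced
      have : IsArtinianRing (TwistedDual J) := IsArtinianRing.of_finite K _
      exact IsArtinianRing.isSemisimpleRing_of_isReduced _
    split := hs.choose_spec.exists_algEquiv }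

variable [TopologicalSpace A] [DiscreteTopology A]

/-- The Galois group acts on the trivializations of a twist through the character of the dual
torsor. -/
theorem mapRingHom_trivialization (p n : ℕ) [Fact p.Prime] [CharP K p] (hA : ∀ a : A, a ^ p ^ n = 1)
    {J : twistGroup K (MonoidAlgebra K A)}
    {x : MonoidAlgebra (AlgebraicClosure K) A} (hx : IsTrivialization J x)
    (g : Gal(AlgebraicClosure K/K)) :
    mapRingHom A ((g : AlgebraicClosure K →ₐ[K] AlgebraicClosure K) :
        AlgebraicClosure K →+* AlgebraicClosure K) x =
      x * single ((dualTorsor p n hA J).galoisCharacter g) 1 := by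
  refine ext_pairing_dualEquiv (J := J) fun f => ?_
  rw [← map_toAlgHom hx, ← toAlgHom_dualAction hx]
  exact (dualTorsor p n hA J).galoisCharacter_spec hx.toAlgHom g f

/-- One trivialization suffices to compute the character, since a unit has distinct translates. -/
theorem galoisCharacter_dualTorsor_eq (p n : ℕ) [Fact p.Prime] [CharP K p]
    (hA : ∀ a : A, a ^ p ^ n = 1) {J : twistGroup K (MonoidAlgebra K A)}
    {x : MonoidAlgebra (AlgebraicClosure K) A} (hx : IsTrivialization J x)
    (φ : Gal(AlgebraicClosure K/K) →ₜ* A)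
    (h : ∀ g : Gal(AlgebraicClosure K/K),
      mapRingHom A ((g : AlgebraicClosure K →ₐ[K] AlgebraicClosure K) :
        AlgebraicClosure K →+* AlgebraicClosure K) x = x * single (φ g) 1) :
    (dualTorsor p n hA J).galoisCharacter = φ := by
  ext g
  refine mul_single_one_injective (hx.isUnit p n hA) ?_
  rw [← mapRingHom_trivialization p n hA hx, h]

end DualTorsor

/-! ### Change of coefficients and descent for group algebras -/

section Coefficients

open MonoidAlgebra

variable {R S A M : Type*} [CommRing R] [CommRing S] [CommGroup A] [CommGroup M]

/-- The ring maps `R[A] → R[M]` given by characters with coefficients fixed by a map of rings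
commute with that map. -/
theorem mapRingHom_lift (g : R →+* S) (χ : A →* M) (x : MonoidAlgebra R A) :
    mapRingHom M g (lift R (MonoidAlgebra R M) A ((of R M).comp χ) x) =
      lift S (MonoidAlgebra S M) A ((of S M).comp χ) (mapRingHom A g x) := by
  induction x using MonoidAlgebra.induction_linear with
  | zero => simp
  | add x y hx hy => simp only [map_add, hx, hy]
  | single a r => simp

variable {K Ω : Type*} [Field K] [Field Ω] [Algebra K Ω]

theorem exists_mapRingHom_eq_of_fixed [Normal K Ω] {z : MonoidAlgebra Ω M}
    (hz : z ∈ (mapRingHom M (algebraMap (separableClosure K Ω) Ω)).range)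
    (hfix : ∀ g : Gal(Ω/K), mapRingHom M ((g : Ω →ₐ[K] Ω) : Ω →+* Ω) z = z) :
    ∃ k : MonoidAlgebra K M, mapRingHom M (algebraMap K Ω) k = z := by
  have : z ∈ Set.range (MonoidAlgebra.map (M := M) (algebraMap K Ω).toAddMonoidHom) := by
    rw [range_map]
    intro m
    refine exists_algebraMap_eq_of_fixed (z := z.coeff m) ?_ fun g => ?_
    · obtain ⟨y, rfl⟩ := hz
      rw [coeff_mapRingHom]
      exact (y.coeff m).2
    · have := congrArg (fun y => y.coeff m) (hfix g)
      rwa [coeff_mapRingHom] at this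
  exact this

theorem counit_eq_augmentation (x : MonoidAlgebra K A) :
    Coalgebra.counit (R := K) x = augmentation K A x := by
  have : Bialgebra.counitAlgHom K (MonoidAlgebra K A) = augmentation K A := by
    ext a; simp
  exact DFunLike.congr_fun this x

theorem augmentation_mapRingHom (g : R →+* S) (x : MonoidAlgebra R A) :
    augmentation S A (mapRingHom A g x) = g (augmentation R A x) := by
  induction x using MonoidAlgebra.induction_linear with
  | zero => simp
  | add x y hx hy => simp only [map_add, hx, hy]
  | single a r => simp

end Coefficients

/-! ### Trivializations and gauge equivalence -/

section Trivializations

open MonoidAlgebra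

variable {K A Ω : Type*} [Field K] [CommGroup A] [Field Ω] [Algebra K Ω]

/-- The universal case of the relation `Δ(x) y = x ⊗ x` implies it for any pair of characters. -/
theorem lift_mul_evalPair {T : Type*} [CommRing T] [Algebra K T] [Algebra Ω T]
    [IsScalarTower K Ω T] {x : MonoidAlgebra Ω A}
    {y : MonoidAlgebra K A ⊗[K] MonoidAlgebra K A}
    (h : lift Ω (MonoidAlgebra Ω (A × A)) A (univFst Ω A * univSnd Ω A) x *
        evalPair K (univFst Ω A) (univSnd Ω A) y =
      lift Ω (MonoidAlgebra Ω (A × A)) A (univFst Ω A) x *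
        lift Ω (MonoidAlgebra Ω (A × A)) A (univSnd Ω A) x) (χ ψ : A →* T) :
    lift Ω T A (χ * ψ) x * evalPair K χ ψ y = lift Ω T A χ x * lift Ω T A ψ x := by
  let θ : MonoidAlgebra Ω (A × A) →ₐ[Ω] T := lift Ω T (A × A) (χ.coprod ψ)
  have hθ : ∀ ω : A →* MonoidAlgebra Ω (A × A),
      θ (lift Ω _ A ω x) = lift Ω T A ((θ : _ →* T).comp ω) x := fun ω => by
    have : θ.comp (lift Ω _ A ω) = lift Ω T A ((θ : _ →* T).comp ω) := by ext; simp
    exact DFunLike.congr_fun this x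
  have h1 : (θ : _ →* T).comp (univFst Ω A) = χ := by ext; simp [θ]
  have h2 : (θ : _ →* T).comp (univSnd Ω A) = ψ := by ext; simp [θ]
  have h3 : θ (evalPair K (univFst Ω A) (univSnd Ω A) y) =
      evalPair K ((θ : _ →* T).comp (univFst Ω A)) ((θ : _ →* T).comp (univSnd Ω A)) y :=
    map_evalPair (θ.restrictScalars K) _ _ y
  have := congrArg θ h
  rwa [map_mul θ, map_mul θ, hθ, hθ, hθ, MonoidHom.comp_mul, h3, h1, h2] at this

/-- The equation Δ(x) J = x ⊗ x is multiplicative in the pair (x, J) because everything commutes. -/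
theorem IsTrivialization.mul {I J : twistGroup K (MonoidAlgebra K A)} {x y : MonoidAlgebra Ω A}
    (hx : IsTrivialization I x) (hy : IsTrivialization J y) : IsTrivialization (I * J) (x * y) := by
  refine ⟨by rw [map_mul, hx.augmentation_eq, hy.augmentation_eq, one_mul], ?_⟩
  have e : twistElem (I * J) = twistElem I * twistElem J := rfl
  have hl : ∀ χ : A →* MonoidAlgebra Ω (A × A), lift Ω (MonoidAlgebra Ω (A × A)) A χ (x * y) =
      lift Ω (MonoidAlgebra Ω (A × A)) A χ x * lift Ω (MonoidAlgebra Ω (A × A)) A χ y :=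
    fun χ => map_mul _ x y
  rw [e, hl, hl, hl, map_mul (evalPair (A := A) K _ _), mul_mul_mul_comm, hx.comul_mul,
    hy.comul_mul, mul_mul_mul_comm]

/-- An invertible element of `K[A]` of augmentation one trivializes the corresponding twist. -/
theorem isTrivialization_of_gaugeEquiv {J : twistGroup K (MonoidAlgebra K A)}
    (hJ : GaugeEquiv K (MonoidAlgebra K A) 1 (twistElem J)) :
    ∃ z : MonoidAlgebra K A, IsTrivialization J (mapRingHom A (algebraMap K Ω) z) := by
  obtain ⟨u, hu, h⟩ := hJ
  -- Here J = Δ(u)(u⁻¹ ⊗ u⁻¹), so the trivialization is the inverse of the gauge element.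
  refine ⟨(u⁻¹ : (MonoidAlgebra K A)ˣ), ?_, ?_⟩
  · rw [augmentation_mapRingHom]
    rw [counit_eq_augmentation] at hu
    have : augmentation K A (u * (u⁻¹ : (MonoidAlgebra K A)ˣ) : MonoidAlgebra K A) = 1 := by
      rw [Units.mul_inv, map_one]
    rw [map_mul, hu, one_mul] at this
    rw [this, map_one]
  · rw [lift_mapRingHom_algebraMap, lift_mapRingHom_algebraMap,
      lift_mapRingHom_algebraMap, h, mul_one, map_mul (evalPair (A := A) K _ _),
      evalPair_comul, evalPair_tmul, ← mul_assoc, ← map_mul (lift K _ A _), Units.inv_mul,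
      map_one, one_mul]

/-- A twist that is trivialized by an element of `K[A]` is gauge equivalent to the trivial one. -/
theorem gaugeEquiv_of_isTrivialization {J : twistGroup K (MonoidAlgebra K A)}
    {z : MonoidAlgebra K A} (hu : IsUnit z)
    (hz : IsTrivialization J (mapRingHom A (algebraMap K Ω) z)) :
    GaugeEquiv K (MonoidAlgebra K A) 1 (twistElem J) := by
  obtain ⟨u, rfl⟩ := hu
  have haug : augmentation K A u = 1 := by
    have := hz.augmentation_eq
    rw [augmentation_mapRingHom] at this
    exact (algebraMap K Ω).injective (this.trans (map_one _).symm)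
  refine ⟨u⁻¹, ?_, ?_⟩
  · rw [counit_eq_augmentation]
    have : augmentation K A (u * (u⁻¹ : (MonoidAlgebra K A)ˣ) : MonoidAlgebra K A) = 1 := by
      rw [Units.mul_inv, map_one]
    rwa [map_mul, haug, one_mul] at this
  · apply evalPair_univ_injective (R := Ω)
    have h := hz.comul_mul
    rw [lift_mapRingHom_algebraMap, lift_mapRingHom_algebraMap,
      lift_mapRingHom_algebraMap] at h
    rw [mul_one, map_mul (evalPair (A := A) K _ _), evalPair_comul, evalPair_tmul, inv_inv, ← h,
      ← mul_assoc, ← map_mul (lift K _ A _), Units.inv_mul,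
      map_one, one_mul]

end Trivializations

/-! ### Constructing twists from semi-invariant elements -/

section TwistOfTrivialization

open MonoidAlgebra

variable {K A Ω : Type*} [Field K] [CommGroup A] [Field Ω] [Algebra K Ω]

/-- An element of `K[A] ⊗ K[A]` that is trivialized over an extension field is a twist. -/
theorem exists_twist_of_comul_mul {x : MonoidAlgebra Ω A} (hx : IsUnit x)
    (haug : augmentation Ω A x = 1) {y : MonoidAlgebra K A ⊗[K] MonoidAlgebra K A}
    (hy : IsUnit y)
    (h : lift Ω (MonoidAlgebra Ω (A × A)) A (univFst Ω A * univSnd Ω A) x *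
        evalPair K (univFst Ω A) (univSnd Ω A) y =
      lift Ω (MonoidAlgebra Ω (A × A)) A (univFst Ω A) x *
        lift Ω (MonoidAlgebra Ω (A × A)) A (univSnd Ω A) x) :
    ∃ J : twistGroup K (MonoidAlgebra K A), IsTrivialization J x := by
  obtain ⟨u, rfl⟩ := hy
  have hone : lift Ω (MonoidAlgebra Ω A) A 1 x = 1 := by
    have : lift Ω (MonoidAlgebra Ω A) A 1 = (Algebra.ofId Ω _).comp (augmentation Ω A) := by
      ext a : 2
      simp [one_def]
    rw [this, AlgHom.comp_apply, haug, map_one]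
  have hof : ∀ z : MonoidAlgebra K A, lift K (MonoidAlgebra Ω A) A (of Ω A) z =
      mapRingHom A (algebraMap K Ω) z := fun z => by
    induction z using MonoidAlgebra.induction_linear with
    | zero => simp
    | add x y hx hy => simp only [map_add, hx, hy]
    | single a r => simp [Algebra.smul_def]
  have hinj : Function.Injective (lift K (MonoidAlgebra Ω A) A (of Ω A)) := fun z w hzw => by
    rw [hof, hof] at hzw
    exact map_injective _ (algebraMap K Ω).injective hzw
  have hX : ∀ {T : Type _} [CommRing T] [Algebra Ω T] (χ : A →* T), IsUnit (lift Ω T A χ x) :=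
    fun χ => hx.map (lift Ω _ A χ)
  refine ⟨⟨u, ?_, ?_, ?_⟩, haug, h⟩
  · apply evalTriple_univ_injective (R := Ω)
    rw [map_mul, map_mul, evalTriple_comulLeft, evalTriple_comulRight, evalTriple_inclLeft,
      evalTriple_inclRight]
    set χ := (of Ω (A × (A × A))).comp (MonoidHom.inl A (A × A))
    set ψ := (of Ω (A × (A × A))).comp ((MonoidHom.inr A (A × A)).comp (MonoidHom.inl A A))
    set ω := (of Ω (A × (A × A))).comp ((MonoidHom.inr A (A × A)).comp (MonoidHom.inr A A))
    have h1 := lift_mul_evalPair h (χ * ψ) ω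
    have h2 := lift_mul_evalPair h χ ψ
    have h3 := lift_mul_evalPair h χ (ψ * ω)
    have h4 := lift_mul_evalPair h ψ ω
    rw [mul_assoc] at h1
    set X : (A →* MonoidAlgebra Ω (A × (A × A))) → MonoidAlgebra Ω (A × (A × A)) :=
      fun χ => lift Ω _ A χ x with hXdef
    set e : (A →* MonoidAlgebra Ω (A × (A × A))) → (A →* MonoidAlgebra Ω (A × (A × A))) →
      MonoidAlgebra Ω (A × (A × A)) := fun χ ψ => evalPair K χ ψ (u : _ ⊗[K] _) with he
    change X (χ * (ψ * ω)) * e (χ * ψ) ω = X (χ * ψ) * X ω at h1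
    change X (χ * ψ) * e χ ψ = X χ * X ψ at h2
    change X (χ * (ψ * ω)) * e χ (ψ * ω) = X χ * X (ψ * ω) at h3
    change X (ψ * ω) * e ψ ω = X ψ * X ω at h4
    change e (χ * ψ) ω * e χ ψ = e χ (ψ * ω) * e ψ ω
    -- After multiplication by the unit X(χψω), both sides of the cocycle identity become X(χ) X(ψ)
    -- X(ω).
    refine (hX (χ * (ψ * ω))).mul_left_cancel ?_
    change X (χ * (ψ * ω)) * _ = X (χ * (ψ * ω)) * _
    calc _ = (X (χ * (ψ * ω)) * e (χ * ψ) ω) * e χ ψ := by ring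
      _ = (X (χ * ψ) * e χ ψ) * X ω := by rw [h1]; ring
      _ = X χ * (X (ψ * ω) * e ψ ω) := by rw [h2, h4]; ring
      _ = (X (χ * (ψ * ω)) * e χ (ψ * ω)) * e ψ ω := by rw [h3]; ring
      _ = _ := by ring
  · have h1 := lift_mul_evalPair h 1 (of Ω A)
    rw [one_mul, hone, one_mul] at h1
    have h2 := (hX (of Ω A)).mul_left_cancel (h1.trans (mul_one _).symm)
    rw [evalPair_one_left] at h2
    -- Every element of K ⊗ K[A] is 1 ⊗ z, and z may be compared with 1 inside Ω[A].
    obtain ⟨z, hz⟩ := (TensorProduct.lid K (MonoidAlgebra K A)).symm.surjective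
      (counitLeft K _ (u : _ ⊗[K] _))
    rw [TensorProduct.lid_symm_apply] at hz
    rw [← hz, Algebra.TensorProduct.productMap_apply_tmul, map_one, one_mul] at h2
    rw [← hz, hinj (h2.trans (map_one _).symm), Algebra.TensorProduct.one_def]
  · have h1 := lift_mul_evalPair h (of Ω A) 1
    rw [mul_one, hone, mul_one] at h1
    have h2 := (hX (of Ω A)).mul_left_cancel (h1.trans (mul_one _).symm)
    rw [evalPair_one_right] at h2
    obtain ⟨z, hz⟩ := (TensorProduct.rid K (MonoidAlgebra K A)).symm.surjective
      (counitRight K _ (u : _ ⊗[K] _))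
    rw [TensorProduct.rid_symm_apply] at hz
    rw [← hz, Algebra.TensorProduct.productMap_apply_tmul, map_one, mul_one] at h2
    rw [← hz, hinj (h2.trans (map_one _).symm), Algebra.TensorProduct.one_def]

/-- An element of augmentation one with separable coefficients on which the Galois group acts
through translations trivializes a twist over the base field. -/
theorem exists_twist_of_semiinvariant [Normal K Ω] (p n : ℕ) [Fact p.Prime] [CharP K p]
    (hA : ∀ a : A, a ^ p ^ n = 1) {x : MonoidAlgebra Ω A}
    (hsep : x ∈ (mapRingHom A (algebraMap (separableClosure K Ω) Ω)).range)
    (haug : augmentation Ω A x = 1) (φ : Gal(Ω/K) → A)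
    (hx : ∀ g : Gal(Ω/K), mapRingHom A ((g : Ω →ₐ[K] Ω) : Ω →+* Ω) x = x * single (φ g) 1) :
    ∃ J : twistGroup K (MonoidAlgebra K A), IsTrivialization J x := by
  have : CharP Ω p := charP_of_injective_algebraMap (algebraMap K Ω).injective p
  set q := p ^ n with hq
  have hq0 : q ≠ 0 := pow_ne_zero n (Fact.out : p.Prime).ne_zero
  have hpow : x ^ q = 1 := by
    rw [hq, MonoidAlgebra.pow_eq_of_torsion p n hA, haug, one_pow, map_one]
  let X : (A →* A × A) → MonoidAlgebra Ω (A × A) := fun χ =>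
    lift Ω (MonoidAlgebra Ω (A × A)) A ((of Ω (A × A)).comp χ) x
  have hXpow : ∀ χ, X χ ^ q = 1 := fun χ => by
    rw [← map_pow (lift Ω (MonoidAlgebra Ω (A × A)) A ((of Ω (A × A)).comp χ)), hpow, map_one]
  have hXsep : ∀ χ, X χ ∈
      (mapRingHom (A × A) (algebraMap (separableClosure K Ω) Ω)).range := fun χ => by
    obtain ⟨y, hy⟩ := hsep
    exact ⟨_, (mapRingHom_lift _ χ y).trans (by rw [hy])⟩
  have hXg : ∀ χ (g : Gal(Ω/K)), mapRingHom (A × A) ((g : Ω →ₐ[K] Ω) : Ω →+* Ω) (X χ) =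
      X χ * single (χ (φ g)) 1 := fun χ g => by
    refine (mapRingHom_lift _ χ x).trans ?_
    rw [hx, map_mul (lift Ω (MonoidAlgebra Ω (A × A)) A ((of Ω (A × A)).comp χ)), lift_single,
      one_smul]
    rfl
  let d := (MonoidHom.id A).prod (MonoidHom.id A)
  have hd : univFst Ω A * univSnd Ω A = (of Ω (A × A)).comp d := by
    ext a; simp [single_mul_single, d]
  -- This is (x ⊗ x) Δ(x)⁻¹. Since x^q = 1, the inverse is a (q-1)-st power, so that separability of
  -- coefficients and the Galois action carry over directly.
  let z := X (MonoidHom.inl A A) * X (MonoidHom.inr A A) * X d ^ (q - 1)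
  obtain ⟨k, hk⟩ := exists_mapRingHom_eq_of_fixed (K := K) (z := z)
    (mul_mem (mul_mem (hXsep _) (hXsep _)) (pow_mem (hXsep _) _)) fun g => by
      have e : (single (MonoidHom.inl A A (φ g)) 1 * single (MonoidHom.inr A A (φ g)) 1 :
          MonoidAlgebra Ω (A × A)) = single (d (φ g)) 1 := by
        simp [single_mul_single, d]
      have e' : (single (d (φ g)) 1 : MonoidAlgebra Ω (A × A)) * single (d (φ g)) 1 ^ (q - 1) =
          1 := by
        rw [mul_pow_sub_one hq0, single_pow, one_pow, ← map_pow, hA, map_one]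
        rfl
      simp only [z, map_mul, map_pow, hXg]
      calc _ = X (MonoidHom.inl A A) * X (MonoidHom.inr A A) * X d ^ (q - 1) *
            ((single (MonoidHom.inl A A (φ g)) 1 * single (MonoidHom.inr A A (φ g)) 1) *
              single (d (φ g)) 1 ^ (q - 1)) := by ring
        _ = _ := by rw [e, e', mul_one]
  have hev : evalPair K (univFst Ω A) (univSnd Ω A) ((tensorEquiv K).symm k) = z := by
    rw [evalPair_univ, LinearEquiv.apply_symm_apply, hk]
  have hzpow : z ^ q = 1 := by
    simp only [z, mul_pow]
    rw [hXpow, hXpow, ← pow_mul, mul_comm (q - 1), pow_mul, hXpow, one_pow, one_mul, one_mul]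
  refine exists_twist_of_comul_mul (IsUnit.of_pow_eq_one hpow hq0) haug
    (y := (tensorEquiv K).symm k) (IsUnit.of_pow_eq_one (n := q) ?_ hq0) ?_
  · apply evalPair_univ_injective (R := Ω)
    rw [map_pow, hev, hzpow, map_one]
  · rw [hev, hd]
    change X d * (X (MonoidHom.inl A A) * X (MonoidHom.inr A A) * X d ^ (q - 1)) =
      X (MonoidHom.inl A A) * X (MonoidHom.inr A A)
    rw [mul_left_comm, mul_pow_sub_one hq0, hXpow, mul_one]

end TwistOfTrivialization

/-! ### Resolvents: realizing a given character -/

section Resolvent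

open MonoidAlgebra

variable {K Ω : Type*} [Field K] [Field Ω] [Algebra K Ω]

theorem AlgEquiv.coe_restrictNormalHom_apply (E : IntermediateField K Ω) [Normal K E]
    (g : Gal(Ω/K)) (v : E) : (AlgEquiv.restrictNormalHom E g v : Ω) = g v :=
  AlgEquiv.restrictNormal_commutes g E v

/-- A finite normal extension contains a separable element whose conjugates sum up to one. -/
theorem exists_sum_galois_eq_one (p : ℕ) [Fact p.Prime] [CharP K p] [Normal K Ω]
    (E : IntermediateField K Ω) [FiniteDimensional K E] [Normal K E] :
    ∃ v : E, (v : Ω) ∈ separableClosure K Ω ∧ ∑ τ : Gal(E/K), τ v = 1 := by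
  have : CharP E p := charP_of_injective_algebraMap (algebraMap K E).injective p
  have : CharP (separableClosure K Ω) p :=
    charP_of_injective_algebraMap (algebraMap K (separableClosure K Ω)).injective p
  have hp : ExpChar (separableClosure K Ω) p := ExpChar.prime Fact.out
  have hp' : ExpChar E p := ExpChar.prime Fact.out
  -- The sum over automorphisms, unlike the field trace of an inseparable extension, is nonzero by
  -- independence of the automorphisms.
  obtain ⟨u, hu⟩ : ∃ u : E, ∑ τ : Gal(E/K), τ u ≠ 0 := by
    by_contra! hcon
    have hli := (linearIndependent_algHom_toLinearMap K E E).comp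
      (fun τ : Gal(E/K) => τ.toAlgHom) AlgEquiv.coe_toAlgHom_injective
    rw [Fintype.linearIndependent_iff] at hli
    refine one_ne_zero (hli (fun _ => 1) (LinearMap.ext fun u => ?_) 1)
    simpa [LinearMap.sum_apply] using hcon u
  -- A p^m-th power of `u` is separable, and the sum of its conjugates is the p^m-th power of the
  -- old sum, hence still nonzero.
  obtain ⟨m, y, hy⟩ := IsPurelyInseparable.pow_mem (separableClosure K Ω) p (u : Ω)
  have hsep : ((u ^ p ^ m : E) : Ω) ∈ separableClosure K Ω := by
    rw [SubmonoidClass.coe_pow, ← hy]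
    exact y.2
  have hne : ∑ τ : Gal(E/K), τ (u ^ p ^ m) ≠ 0 := by
    simp only [map_pow]
    rw [← sum_pow_char_pow]
    exact pow_ne_zero _ hu
  set w := u ^ p ^ m
  have hmem : ∀ τ : Gal(E/K), (τ w : Ω) ∈ separableClosure K Ω := fun τ => by
    obtain ⟨g, rfl⟩ := AlgEquiv.restrictNormalHom_surjective (F := K) (K₁ := E) Ω τ
    rw [AlgEquiv.coe_restrictNormalHom_apply]
    exact (map_mem_separableClosure_iff (g : Ω →ₐ[K] Ω)).2 hsep
  -- The sum is Galois-invariant and separable, so it is a nonzero scalar of K by which one can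
  -- divide.
  obtain ⟨k, hk⟩ := exists_algebraMap_eq_of_fixed (K := K)
    (z := ((∑ τ : Gal(E/K), τ w : E) : Ω))
    (by
      rw [AddSubmonoidClass.coe_finsetSum]
      exact sum_mem fun τ _ => hmem τ) fun g => by
      rw [← AlgEquiv.coe_restrictNormalHom_apply, map_sum]
      congr 1
      exact Fintype.sum_equiv (Equiv.mulLeft (AlgEquiv.restrictNormalHom E g)) _ _ fun τ => rfl
  have hk' : algebraMap K E k = ∑ τ : Gal(E/K), τ w := Subtype.ext hk
  have hk0 : k ≠ 0 := by
    rintro rfl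
    exact hne (by rw [← hk', map_zero])
  refine ⟨k⁻¹ • w, (separableClosure K Ω).smul_mem hsep, ?_⟩
  simp only [map_smul]
  rw [← Finset.smul_sum, ← hk', Algebra.smul_def, ← map_mul, inv_mul_cancel₀ hk0, map_one]

variable {A : Type*} [CommGroup A] [TopologicalSpace A] [DiscreteTopology A]

/-- Every continuous character of the Galois group is given by the action on an element of
augmentation one of the group algebra. -/
theorem exists_semiinvariant (p : ℕ) [Fact p.Prime] [CharP K p] [Normal K Ω]
    (φ : Gal(Ω/K) →ₜ* A) :
    ∃ x : MonoidAlgebra Ω A, x ∈ (mapRingHom A (algebraMap (separableClosure K Ω) Ω)).range ∧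
      augmentation Ω A x = 1 ∧
      ∀ g : Gal(Ω/K), mapRingHom A ((g : Ω →ₐ[K] Ω) : Ω →+* Ω) x = x * single (φ g) 1 := by
  have hnhds : (φ ⁻¹' {1} : Set Gal(Ω/K)) ∈ nhds 1 :=
    ((isOpen_discrete {(1 : A)}).preimage φ.continuous_toFun).mem_nhds (map_one φ)
  -- By continuity φ is trivial on the subgroup fixing a finite normal E, so it factors through the
  -- automorphism group of E.
  obtain ⟨E, hfin, hnorm, hE⟩ := (krullTopology_mem_nhds_one_iff_of_normal K Ω _).1 hnhds
  have hker : ∀ g g' : Gal(Ω/K), AlgEquiv.restrictNormalHom E g = AlgEquiv.restrictNormalHom E g' →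
      φ g = φ g' := by
    intro g g' h
    have : g⁻¹ * g' ∈ E.fixingSubgroup := by
      rw [IntermediateField.mem_fixingSubgroup_iff]
      intro v hv
      have := congrArg (fun τ : Gal(E/K) => ((τ ⟨v, hv⟩ : E) : Ω)) h
      simp only [AlgEquiv.coe_restrictNormalHom_apply] at this
      rw [AlgEquiv.mul_apply, ← this, ← AlgEquiv.mul_apply, inv_mul_cancel,
        AlgEquiv.one_apply]
    have h1 : φ (g⁻¹ * g') = 1 := hE this
    rwa [map_mul, map_inv, inv_mul_eq_one] at h1
  choose s hs using AlgEquiv.restrictNormalHom_surjective (F := K) (K₁ := E) Ω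
  obtain ⟨v, hv, hsum⟩ := exists_sum_galois_eq_one p E
  -- A Lagrange resolvent. Applying `g` reindexes τ by g τ, and the inverse in φ(τ)⁻¹ makes the
  -- factor φ(g) come out on the right; the augmentation is Σ τ(v) = 1.
  refine ⟨∑ τ : Gal(E/K), single (φ (s τ))⁻¹ (τ v : Ω), ?_, ?_, fun g => ?_⟩
  · refine sum_mem fun τ _ => ?_
    have hτ : (τ v : Ω) ∈ separableClosure K Ω := by
      rw [← hs τ, AlgEquiv.coe_restrictNormalHom_apply]
      exact (map_mem_separableClosure_iff ((s τ : Gal(Ω/K)) : Ω →ₐ[K] Ω)).2 hv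
    exact ⟨single _ ⟨_, hτ⟩, mapRingHom_single _ _ _⟩
  · rw [map_sum]
    simp only [augmentation_single]
    rw [← AddSubmonoidClass.coe_finsetSum, hsum]
    rfl
  · rw [map_sum, Finset.sum_mul]
    refine Fintype.sum_equiv (Equiv.mulLeft (AlgEquiv.restrictNormalHom E g)) _ _ fun τ => ?_
    have h1 : φ (s (AlgEquiv.restrictNormalHom E g * τ)) = φ g * φ (s τ) := by
      rw [← map_mul]
      exact hker _ _ (by rw [hs, map_mul, hs])
    rw [mapRingHom_single, single_mul_single, Equiv.coe_mulLeft, h1, mul_inv_rev,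
      inv_mul_cancel_right, mul_one, AlgEquiv.mul_apply, AlgEquiv.coe_restrictNormalHom_apply]
    rfl

end Resolvent

/-! ### The product of torsors corresponds to the product of characters -/

section TorsorProduct

universe u v

variable {K : Type u} {A : Type v} [Field K] [CommGroup A]

namespace ATorsor

variable (B C : ATorsor K A)

/-- The points of `B ⊗ C` given by the translates of points of `B` and `C`. -/
def pairPoint (f : B.carrier →ₐ[K] AlgebraicClosure K) (h : C.carrier →ₐ[K] AlgebraicClosure K)
    (s : A × A) : B.carrier ⊗[K] C.carrier →ₐ[K] AlgebraicClosure K :=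
  Algebra.TensorProduct.productMap (translatePoint B.ρ f s.1) (translatePoint C.ρ h s.2)

variable {B C} (f : B.carrier →ₐ[K] AlgebraicClosure K) (h : C.carrier →ₐ[K] AlgebraicClosure K)

theorem pairPoint_map (s : A × A) (a b : A) (y : B.carrier ⊗[K] C.carrier) :
    pairPoint B C f h s (Algebra.TensorProduct.map (B.ρ a).toAlgHom (C.ρ b).toAlgHom y) =
      pairPoint B C f h (s.1 * a, s.2 * b) y := by
  have : (pairPoint B C f h s).comp
      (Algebra.TensorProduct.map (B.ρ a).toAlgHom (C.ρ b).toAlgHom) =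
      pairPoint B C f h (s.1 * a, s.2 * b) := by
    refine Algebra.TensorProduct.ext' fun y z => ?_
    simp [pairPoint]
  exact DFunLike.congr_fun this y

theorem pairPoint_actLeft (s : A × A) (a : A) (y : B.carrier ⊗[K] C.carrier) :
    pairPoint B C f h s (actLeft (C := C.carrier) B.ρ a y) =
      pairPoint B C f h (s.1 * a, s.2) y := by
  have := pairPoint_map f h s a 1 y
  rwa [map_one, mul_one] at this

/-- Invariance under (a, a⁻¹) allows the second index to be moved to the first, so only the product
of the indices matters. -/
theorem pairPoint_eq_of_mem {y : B.carrier ⊗[K] C.carrier} (hy : y ∈ antiInvariants B.ρ C.ρ)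
    (s : A × A) : pairPoint B C f h s y = pairPoint B C f h (s.1 * s.2, 1) y := by
  conv_lhs => rw [← hy s.2]
  rw [pairPoint_map, mul_inv_cancel]

variable [Fintype A]

theorem splittingFamily_pairPoint : SplittingFamily (pairPoint B C f h) := by
  have hB := B.splittingFamily f
  have hC := C.splittingFamily h
  have := hB.finite
  have := hC.finite
  refine ⟨inferInstance, fun s t e => Prod.ext (hB.injective ?_) (hC.injective ?_), ?_⟩
  · have := congrArg (fun F => F.comp Algebra.TensorProduct.includeLeft) e
    simpa only [pairPoint, Algebra.TensorProduct.productMap_left] using this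
  · have := congrArg (fun F => F.comp Algebra.TensorProduct.includeRight) e
    simpa only [pairPoint, Algebra.TensorProduct.productMap_right] using this
  · rw [Fintype.card_prod, Module.finrank_tensorProduct, ← hB.card_eq, ← hC.card_eq]

variable [TopologicalSpace A] [DiscreteTopology A]

theorem galois_pairPoint (g : Gal(AlgebraicClosure K/K)) (s : A × A)
    (y : B.carrier ⊗[K] C.carrier) :
    g (pairPoint B C f h s y) =
      pairPoint B C f h (s.1 * B.galoisCharacter g, s.2 * C.galoisCharacter g) y := by
  have : (g : AlgebraicClosure K →ₐ[K] AlgebraicClosure K).comp (pairPoint B C f h s) =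
      pairPoint B C f h (s.1 * B.galoisCharacter g, s.2 * C.galoisCharacter g) := by
    refine Algebra.TensorProduct.ext' fun y z => ?_
    change g (f (B.ρ s.1 y) * h (C.ρ s.2 z)) =
      f (B.ρ (s.1 * B.galoisCharacter g) y) * h (C.ρ (s.2 * C.galoisCharacter g) z)
    rw [map_mul, galoisCharacter_spec, galoisCharacter_spec, ← AlgEquiv.mul_apply,
      ← AlgEquiv.mul_apply, ← map_mul, ← map_mul, mul_comm, mul_comm (C.galoisCharacter g),
      mul_comm (B.galoisCharacter g), mul_comm]
  exact DFunLike.congr_fun this y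

/-- On invariants a pair of points is known by the product of its indices, and Galois multiplies
that product by both characters. -/
theorem galoisCharacter_of_equivariantIso_antiInvariants {D : ATorsor K A}
    (hD : EquivariantIso D.ρ (antiInvariantsAction B.ρ C.ρ)) :
    D.galoisCharacter = B.galoisCharacter * C.galoisCharacter := by
  obtain ⟨e, he⟩ := hD
  refine D.galoisCharacter_eq (((pairPoint B C B.point C.point 1).comp
    (antiInvariants B.ρ C.ρ).val).comp e.toAlgHom) _ fun g x => ?_
  change g (pairPoint B C B.point C.point 1 (e x : B.carrier ⊗[K] C.carrier)) =
    pairPoint B C B.point C.point 1 (e _ : B.carrier ⊗[K] C.carrier)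
  rw [he, galois_pairPoint, pairPoint_eq_of_mem _ _ (e x).2]
  refine Eq.trans ?_ (pairPoint_actLeft _ _ _ _ _).symm
  simp

theorem equivariantIso_antiInvariants_of_galoisCharacter (p : ℕ) [Fact p.Prime] [CharP K p]
    {D : ATorsor K A} (hD : D.galoisCharacter = B.galoisCharacter * C.galoisCharacter) :
    EquivariantIso D.ρ (antiInvariantsAction B.ρ C.ρ) := by
  have hpair := splittingFamily_pairPoint B.point C.point
  have hgal : ∀ g, D.galoisCharacter g = B.galoisCharacter g * C.galoisCharacter g := fun g => by
    rw [hD]; rfl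
  -- D maps to B ⊗ C by prescribing its value at the pair (s₁, s₂) as the value at the
  -- s₁s₂-translate of the point of D.
  obtain ⟨e, he⟩ := hpair.exists_algHom p (fun s => translatePoint D.ρ D.point (s.1 * s.2))
    (fun s v => (D.splittingFamily D.point).mem_separableClosure p _ v) fun g s =>
      ⟨(s.1 * (B.galoisCharacter g)⁻¹, s.2 * (C.galoisCharacter g)⁻¹), fun v => by
        rw [galois_pairPoint, inv_mul_cancel_right, inv_mul_cancel_right], fun v => by
        rw [translatePoint_apply, galoisCharacter_spec, hgal, ← AlgEquiv.mul_apply, ← map_mul,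
          translatePoint_apply]
        have hs : B.galoisCharacter g * C.galoisCharacter g *
            (s.1 * (B.galoisCharacter g)⁻¹ * (s.2 * (C.galoisCharacter g)⁻¹)) = s.1 * s.2 := by
          rw [mul_mul_mul_comm s.1, ← mul_inv, mul_inv_cancel_comm_assoc]
        exact congrArg (fun c => D.point (D.ρ c v)) hs⟩
  -- In the other direction, an invariant is determined by its values at the pairs (c, 1).
  obtain ⟨e', he'⟩ := (D.splittingFamily D.point).exists_algHom p
    (fun c => (pairPoint B C B.point C.point (c, 1)).comp (antiInvariants B.ρ C.ρ).val)
    (fun s v => hpair.mem_separableClosure p _ _) fun g c =>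
      ⟨c * (D.galoisCharacter g)⁻¹, fun v => by
        rw [translatePoint_apply, galoisCharacter_spec, ← AlgEquiv.mul_apply, ← map_mul,
          mul_inv_cancel_comm_assoc, translatePoint_apply], fun v => by
        change g (pairPoint B C B.point C.point _ (v : B.carrier ⊗[K] C.carrier)) =
          pairPoint B C B.point C.point _ (v : B.carrier ⊗[K] C.carrier)
        rw [galois_pairPoint, pairPoint_eq_of_mem _ _ v.2]
        congr 3
        simp [hgal, mul_assoc]⟩
  have hmem : ∀ v, e v ∈ antiInvariants B.ρ C.ρ := fun v a => hpair.ext_points fun s => by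
    rw [pairPoint_map, he, he, mul_mul_mul_comm, mul_inv_cancel, mul_one]
  have he'' : ∀ c v, D.point (D.ρ c (e' v)) =
      pairPoint B C B.point C.point (c, 1) (v : B.carrier ⊗[K] C.carrier) := fun c v => he' c v
  refine ⟨AlgEquiv.ofAlgHom (e.codRestrict _ hmem) e' (AlgHom.ext fun v => Subtype.ext ?_)
    (AlgHom.ext fun v => ?_), fun a v => Subtype.ext ?_⟩
  · refine hpair.ext_points fun s => ?_
    change pairPoint B C B.point C.point s (e (e' v)) =
      pairPoint B C B.point C.point s (v : B.carrier ⊗[K] C.carrier)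
    rw [he, translatePoint_apply, he'', ← pairPoint_eq_of_mem _ _ v.2]
  · refine (D.splittingFamily D.point).ext_points fun c => ?_
    refine (he'' c _).trans ?_
    change pairPoint B C B.point C.point (c, 1) (e v) = _
    rw [he, mul_one]
    rfl
  · refine hpair.ext_points fun s => ?_
    refine Eq.trans ?_ (pairPoint_actLeft _ _ _ _ _).symm
    change pairPoint B C B.point C.point s (e (D.ρ a v)) =
      pairPoint B C B.point C.point (s.1 * a, s.2) (e v)
    rw [he, he, translatePoint_apply, translatePoint_apply, ← AlgEquiv.mul_apply, ← map_mul,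
      mul_right_comm]

end ATorsor

end TorsorProduct

/-! ### The classification isomorphisms -/

section Classification

open MonoidAlgebra

universe u v

variable {K : Type u} {A : Type v} [Field K] [CommGroup A] [Fintype A]

/-- The coefficients of a trivialization over an algebraic closure are separable. -/
theorem IsTrivialization.mem_range_mapRingHom (p n : ℕ) [Fact p.Prime] [CharP K p]
    (hA : ∀ a : A, a ^ p ^ n = 1) {J : twistGroup K (MonoidAlgebra K A)}
    {x : MonoidAlgebra (AlgebraicClosure K) A} (hx : IsTrivialization J x) :
    x ∈ (mapRingHom A (algebraMap (separableClosure K (AlgebraicClosure K))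
      (AlgebraicClosure K))).range := by
  classical
  have := twistedDual_isCocomm J p n hA
  have key : x ∈ Set.range (MonoidAlgebra.map (M := A)
      (algebraMap (separableClosure K (AlgebraicClosure K))
        (AlgebraicClosure K)).toAddMonoidHom) := by
    rw [range_map]
    intro a
    have hmem := ((dualTorsor p n hA J).splittingFamily hx.toAlgHom).mem_separableClosure p 1
      ((dualEquiv J).symm (Pi.single a 1))
    change hx.toAlgHom (dualAction J 1 _) ∈ _ at hmem
    rw [map_one] at hmem
    -- The coefficients of `x` are the values of the corresponding point on delta functions, and
    -- points of a torsor have separable values.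
    have e : hx.toAlgHom ((dualEquiv J).symm (Pi.single a 1)) = x.coeff a := by
      rw [hx.toAlgHom_apply]
      simp [pairing, Pi.single_apply, apply_ite, Finsupp.linearCombination_apply,
        Finsupp.sum_fintype]
    exact ⟨⟨_, hmem⟩, e⟩
  exact key

variable [TopologicalSpace A] [DiscreteTopology A]
variable (p n : ℕ) [Fact p.Prime] [CharP K p] (hA : ∀ a : A, a ^ p ^ n = 1)

/-- The homomorphism sending a twist to the character of its dual torsor. -/
def twistCharacter :
    twistGroup K (MonoidAlgebra K A) →* (Gal(AlgebraicClosure K/K) →ₜ* A) :=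
  MonoidHom.mk' (fun J => (dualTorsor p n hA J).galoisCharacter) fun I J => by
    obtain ⟨x, hx⟩ := exists_trivialization p n hA I (AlgebraicClosure K)
    obtain ⟨y, hy⟩ := exists_trivialization p n hA J (AlgebraicClosure K)
    refine galoisCharacter_dualTorsor_eq p n hA (hx.mul hy) _ fun g => ?_
    rw [map_mul, mapRingHom_trivialization p n hA hx, mapRingHom_trivialization p n hA hy,
      mul_mul_mul_comm, single_mul_single, one_mul]
    rfl

theorem twistCharacter_apply (J : twistGroup K (MonoidAlgebra K A)) :
    twistCharacter p n hA J = (dualTorsor p n hA J).galoisCharacter := rfl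

/-- The character is trivial exactly when a trivialization is Galois-invariant; having separable
coefficients, it then lies in K[A] and is the inverse of a gauge element. -/
theorem ker_twistCharacter :
    (twistCharacter (K := K) p n hA).ker = trivialTwists K (MonoidAlgebra K A) := by
  ext J
  rw [MonoidHom.mem_ker, twistCharacter_apply]
  constructor
  · intro h
    obtain ⟨x, hx⟩ := exists_trivialization p n hA J (AlgebraicClosure K)
    obtain ⟨z, rfl⟩ := exists_mapRingHom_eq_of_fixed (hx.mem_range_mapRingHom p n hA) fun g => by
      rw [mapRingHom_trivialization p n hA hx, h]
      exact mul_one x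
    refine gaugeEquiv_of_isTrivialization
      (MonoidAlgebra.isUnit_of_isUnit_augmentation p n hA ?_) hx
    have := hx.augmentation_eq
    rw [augmentation_mapRingHom] at this
    rw [(algebraMap K (AlgebraicClosure K)).injective (this.trans (map_one _).symm)]
    exact isUnit_one
  · intro h
    obtain ⟨z, hz⟩ := isTrivialization_of_gaugeEquiv (Ω := AlgebraicClosure K) h
    refine galoisCharacter_dualTorsor_eq p n hA hz 1 fun g => ?_
    have e : ((g : AlgebraicClosure K →ₐ[K] AlgebraicClosure K) :
        AlgebraicClosure K →+* AlgebraicClosure K).comp (algebraMap K (AlgebraicClosure K)) =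
          algebraMap K (AlgebraicClosure K) := RingHom.ext fun r => g.commutes r
    have h1 : mapRingHom A (algebraMap K (AlgebraicClosure K)) z *
        single ((1 : Gal(AlgebraicClosure K/K) →ₜ* A) g) 1 =
          mapRingHom A (algebraMap K (AlgebraicClosure K)) z := mul_one _
    rw [h1]
    ext a
    simp only [coeff_mapRingHom]
    exact g.commutes _

theorem twistCharacter_surjective : Function.Surjective (twistCharacter (K := K) p n hA) := by
  intro φ
  obtain ⟨x, hsep, haug, hx⟩ := exists_semiinvariant (Ω := AlgebraicClosure K) p φ
  obtain ⟨J, hJ⟩ := exists_twist_of_semiinvariant p n hA hsep haug φ hx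
  exact ⟨J, galoisCharacter_dualTorsor_eq p n hA hJ φ hx⟩

/-- Gauge equivalence classes of twists are classified by characters of the Galois group. -/
def twistClassesEquiv : H2inv A K ≃* (Gal(AlgebraicClosure K/K) →ₜ* A) :=
  (QuotientGroup.quotientMulEquivOfEq (ker_twistCharacter p n hA).symm).trans
    (QuotientGroup.quotientKerEquivOfSurjective _ (twistCharacter_surjective p n hA))

theorem twistClassesEquiv_mk (J : twistGroup K (MonoidAlgebra K A)) :
    twistClassesEquiv p n hA (QuotientGroup.mk J) = (dualTorsor p n hA J).galoisCharacter := rfl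

/-- The character of an isomorphism class of torsors. -/
def TorsorClasses.galoisCharacter : TorsorClasses K A → (Gal(AlgebraicClosure K/K) →ₜ* A) :=
  Quotient.lift ATorsor.galoisCharacter fun _ _ h =>
    ATorsor.galoisCharacter_eq_of_equivariantIso h

/-- Isomorphism classes of torsors are classified by characters of the Galois group. -/
def torsorClassesEquiv : TorsorClasses K A ≃ (Gal(AlgebraicClosure K/K) →ₜ* A) :=
  Equiv.ofBijective TorsorClasses.galoisCharacter
    ⟨fun b c => Quotient.inductionOn₂ b c fun _ _ h =>
      Quotient.sound (ATorsor.equivariantIso_of_galoisCharacter_eq p h),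
    -- Every character already comes from the dual of a twist, so no separate construction of
    -- torsors is needed.
    fun φ => (twistCharacter_surjective p n hA φ).imp' (fun J => (dualTorsor p n hA J).cls)
      fun _ h => h⟩

end Classification

end

theorem lemma3p3 {K : Type*} [Field K] (p : ℕ) [Fact p.Prime] [CharP K p]
    {A : Type*} [CommGroup A] [Finite A] [TopologicalSpace A] [DiscreteTopology A]
    (hA : IsPGroup p A) :
    ∃ (_ : CommGroup (TorsorClasses K A))
      (e₁ : H2inv A K ≃* TorsorClasses K A)
      (e₂ : TorsorClasses K A ≃* (Gal(AlgebraicClosure K/K) →ₜ* A)),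
      (∀ B C D : ATorsor K A, B.cls * C.cls = D.cls ↔
        EquivariantIso D.ρ (antiInvariantsAction B.ρ C.ρ)) ∧
      (∀ (J : twistGroup K (MonoidAlgebra K A)) (B : ATorsor K A),
        e₁ (QuotientGroup.mk J) = B.cls ↔ EquivariantIso B.ρ (dualAction J)) ∧
      (∀ (B : ATorsor K A) (f : B.carrier →ₐ[K] AlgebraicClosure K)
        (g : Gal(AlgebraicClosure K/K)) (x : B.carrier),
        g (f x) = f (B.ρ (e₂ B.cls g) x)) := by
  have := Fintype.ofFinite A
  obtain ⟨n, hn⟩ := hA.exists_pow_eq_one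
  -- The group law is transported from the characters, which makes the group axioms automatic; its
  -- description by invariants of tensor products is then an equality of characters.
  let _ := (torsorClassesEquiv (K := K) p n hn).commGroup
  let e : TorsorClasses K A ≃* (Gal(AlgebraicClosure K/K) →ₜ* A) :=
    (torsorClassesEquiv p n hn).mulEquiv
  have he : ∀ B : ATorsor K A, e B.cls = B.galoisCharacter := fun B => rfl
  refine ⟨inferInstance, (twistClassesEquiv p n hn).trans e.symm, e, fun B C D => ?_,
    fun J B => ?_, fun B f g x => ?_⟩
  · rw [← e.injective.eq_iff, map_mul, he, he, he, eq_comm]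
    exact ⟨ATorsor.equivariantIso_antiInvariants_of_galoisCharacter p,
      ATorsor.galoisCharacter_of_equivariantIso_antiInvariants⟩
  · rw [MulEquiv.trans_apply, MulEquiv.symm_apply_eq, he, twistClassesEquiv_mk, eq_comm]
    exact ⟨ATorsor.equivariantIso_of_galoisCharacter_eq p (C := dualTorsor p n hn J),
      ATorsor.galoisCharacter_eq_of_equivariantIso (C := dualTorsor p n hn J)⟩
  · rw [he]
    exact B.galoisCharacter_spec f g x
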